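/- **Setting.** Let $\mathcal T$ be a locally compact complete separable metric space with a Radon measure $m$ on its Borel sets. An *indexing collection* is a class $\mathcal A$ of compact connected subsets of $\mathcal T$ such that: (1) $\emptyset\in\mathcal A$, and $U^\circ\ne U$ for $U\in\mathcal A\setminus\{\emptyset,\mathcal T\}$; (2) $\mathcal A$ is closed under arbitrary (nonempty) intersections, two nonempty members of $\mathcal A$ have nonempty intersection, and $\overline{\bigcup_i U_i}\in\mathcal A$ for every increasing sequence $(U_i)$ in $\mathcal A$; (3) $\mathcal A$ generates the Borel $\sigma$-algebra; (4) there is an increasing sequence of finite subclasses $\mathcal A_n\subseteq\mathcal A$, closed under intersections, containing $\emptyset$ and a nonempty set, such that $g_n(U)=\bigcap\{V\in\mathcal A_n: U\subseteq V^\circ\}$ belongs to $\mathcal A_n$ and $U=\bigcap_n g_n(U)$, for all $U\in\mathcal A$. Put $k_n=\#\mathcal A_n$ and let $\mathcal A$ carry the pseudo-distance $d_m(U,V)=m(U\triangle V)$, with open balls $B(U_0,\rho)$. *Assumption on $(\mathcal A_n)$.* The sequence is admissible, i.e. $\sum_n k_{n+1}k_n^{-(1+\delta)}<\infty$ for every $\delta>0$,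 and there are $q,M>0$ with $d_m(U,g_n(U))\le M k_n^{-1/q}$ for all $n$ and all $U\in\mathcal A$. Let $\sigma,\gamma>0$ and let $Y=\{Y_U;U\in\mathcal A\}$ be a stationary set-indexed Ornstein–Uhlenbeck process, i.e. a mean-zero Gaussian process with $\mathbf E[Y_UY_V]=\frac{\sigma^2}{2\gamma}e^{-\gamma m(U\triangle V)}$. Assume that $Y$ is separable (in the sense of Doob) for the topology of $d_m$. *Exponents.* For $f:\mathcal A\to\mathbf R$ and $U_0\in\mathcal A$, $$\alpha_f(U_0)=\sup\Big\{\alpha\in\mathbf R:\limsup_{\rho\to0^+}\sup_{U,V\in B(U_0,\rho)}\tfrac{|f(U)-f(V)|}{\rho^\alpha}<\infty\Big\},\qquad \tilde\alpha_f(U_0)=\sup\Big\{\alpha\in\mathbf R:\limsup_{\rho\to0^+}\sup_{U,V\in B(U_0,\rho)}\tfrac{|f(U)-f(V)|}{d_m(U,V)^\alpha}<\infty\Big\}.$$ With $\Delta f_{U;V_1,\dots,V_l}=\sum_{J\subseteq\{1,\dots,l\}}(-1)^{\#J}f\big(U\cap\bigcap_{j\in J}V_j\big)$, the $\mathcal C^l$-exponents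 $\alpha_{f,\mathcal C^l}(U_0)$ and $\tilde\alpha_{f,\mathcal C^l}(U_0)$ are defined in the same way, with the supremum over $U,V_1,\dots,V_l\in B(U_0,\rho)$ of $|\Delta f_{U;V_1,\dots,V_l}|/\rho^\alpha$, respectively of $|\Delta f_{U;V_1,\dots,V_l}|/m\big(U\triangle\bigcup_iV_i\big)^\alpha$. Quotients are taken in $[0,\infty]$ with $0/0=0$ and $x/0=\infty$ for $x>0$; suprema are taken in $[-\infty,\infty]$. Call $U_0\in\mathcal A$ *non-isolated* if for every $\rho>0$ there is $U\in\mathcal A$ with $0<d_m(U_0,U)<\rho$. (If $m$ is not concentrated on the singleton $\bigcap\{U\in\mathcal A:U\neq\emptyset\}$, every nonempty $U_0\in\mathcal A$ is non-isolated; $\emptyset$ is isolated when this singleton has positive mass.) **Proposition.** Under these assumptions: 1. with probability one, simultaneously for all $U_0\in\mathcal A$: $\alpha_Y(U_0)\ge\frac12$, and $\tilde\alpha_Y(U_0)=\frac12$ if $U_0$ is non-isolated; 2. for each fixed non-isolated $U_0\in\mathcal A$, $\alpha_Y(U_0)=\frac12$ almost surely; 3. for each fixed non-isolated $U_0\in\mathcal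 A$, almost surely $\alpha_{Y,\mathcal C^l}(U_0)=\frac12$ for every $l\ge1$, and $\tilde\alpha_{Y,\mathcal C^1}(U_0)=\frac12$. -/

import Mathlib

open MeasureTheory ProbabilityTheory Filter Topology
open scoped ENNReal

noncomputable section

namespace SetIndexed

variable {T : Type*}

/-- `g(U)`: the intersection of all members `V` of the finite class `D` whose interior contains
`U` (with the usual convention that an empty intersection is the whole space). -/
def outerApprox [TopologicalSpace T] (D : Finset (Set T)) (U : Set T) : Set T :=
  ⋂ V ∈ {V : Set T | V ∈ D ∧ U ⊆ interior V}, V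

/-- `A` is an indexing collection on `T`, and `D 0 ⊆ D 1 ⊆ ⋯` is a sequence of finite subclasses
that separates it from above. -/
structure IsIndexingCollection [TopologicalSpace T] (A : Set (Set T))
    (D : ℕ → Finset (Set T)) : Prop where
  isCompact : ∀ U ∈ A, IsCompact U
  isPreconnected : ∀ U ∈ A, IsPreconnected U
  empty_mem : ∅ ∈ A
  interior_ne : ∀ U ∈ A, U ≠ ∅ → U ≠ Set.univ → interior U ≠ U
  sInter_mem : ∀ S ⊆ A, S.Nonempty → ⋂₀ S ∈ A
  inter_nonempty : ∀ U ∈ A, ∀ V ∈ A, U.Nonempty → V.Nonempty → (U ∩ V).Nonempty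
  closure_iUnion_mem : ∀ U : ℕ → Set T, Monotone U → (∀ n, U n ∈ A) → closure (⋃ n, U n) ∈ A
  generateFrom_eq : MeasurableSpace.generateFrom A = borel T
  sub_subset : ∀ n, ∀ U ∈ D n, U ∈ A
  sub_mono : Monotone D
  sub_empty_mem : ∀ n, ∅ ∈ D n
  sub_nontrivial : ∀ n, ∃ U ∈ D n, U.Nonempty
  sub_inter_mem : ∀ n, ∀ U ∈ D n, ∀ V ∈ D n, U ∩ V ∈ D n
  outerApprox_mem : ∀ n, ∀ U ∈ A, outerApprox (D n) U ∈ D n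
  iInter_outerApprox : ∀ U ∈ A, ⋂ n, outerApprox (D n) U = U

/-- The pseudo-distance `d_m(U, V) = m (U ∆ V)`. -/
def dm [MeasurableSpace T] (m : Measure T) (U V : Set T) : ℝ≥0∞ :=
  m (symmDiff U V)

/-- The open ball of `(A, d_m)`. -/
def ball [MeasurableSpace T] (m : Measure T) (A : Set (Set T)) (U₀ : Set T) (ρ : ℝ≥0∞) :
    Set (Set T) :=
  {U | U ∈ A ∧ dm m U₀ U < ρ}

/-- Admissibility of the cardinalities `k n = #(D n)`: the series `∑ k (n+1) / k n ^ (1 + δ)`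
converges for every `δ > 0`. -/
def Admissible (D : ℕ → Finset (Set T)) : Prop :=
  ∀ δ : ℝ, 0 < δ →
    Summable fun n : ℕ => ((D (n + 1)).card : ℝ) / ((D n).card : ℝ) ^ (1 + δ)

/-- The discretization assumption for the pseudo-distance `d_m`, in the form used for Gaussian
processes: the cardinalities are admissible, and for some discretization exponent `q > 0`
the distance from any `U ∈ A` to its `n`-th outer approximation is `O(k n ^ (-1 / q))`. -/
structure DiscretizationAssumption [TopologicalSpace T] [MeasurableSpace T] (m : Measure T)
    (A : Set (Set T)) (D : ℕ → Finset (Set T)) : Prop where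
  admissible : Admissible D
  exists_exponent : ∃ q : ℝ, 0 < q ∧ ∃ M : ℝ, 0 < M ∧ ∀ n, ∀ U ∈ A,
    dm m U (outerApprox (D n) U) ≤ ENNReal.ofReal (M * ((D n).card : ℝ) ^ (-1 / q))

/-- `U₀` is not an isolated point of `(A, d_m)`: there are members of `A` at arbitrarily small
positive distance of `U₀`. -/
def NotIsolated [MeasurableSpace T] (m : Measure T) (A : Set (Set T)) (U₀ : Set T) : Prop :=
  ∀ ρ : ℝ≥0∞, 0 < ρ → ∃ U ∈ A, 0 < dm m U₀ U ∧ dm m U₀ U < ρ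

/-- Pointwise Hölder exponent of `f : A → ℝ` at `U₀` with respect to `d_m`. Only the values of `f`
on `A` matter; quotients are taken in `[0, ∞]`, with `0 / 0 = 0` and `x / 0 = ∞` for `x > 0`. -/
def pointwiseExponent [MeasurableSpace T] (m : Measure T) (A : Set (Set T)) (f : Set T → ℝ)
    (U₀ : Set T) : EReal :=
  sSup ((fun α : ℝ => (α : EReal)) '' {α : ℝ |
    limsup (fun ρ : ℝ≥0∞ => ⨆ U ∈ ball m A U₀ ρ, ⨆ V ∈ ball m A U₀ ρ,
      ENNReal.ofReal |f U - f V| / ρ ^ α) (𝓝[>] 0) < ∞})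

/-- Local Hölder exponent of `f : A → ℝ` at `U₀` with respect to `d_m`. -/
def localExponent [MeasurableSpace T] (m : Measure T) (A : Set (Set T)) (f : Set T → ℝ)
    (U₀ : Set T) : EReal :=
  sSup ((fun α : ℝ => (α : EReal)) '' {α : ℝ |
    limsup (fun ρ : ℝ≥0∞ => ⨆ U ∈ ball m A U₀ ρ, ⨆ V ∈ ball m A U₀ ρ,
      ENNReal.ofReal |f U - f V| / dm m U V ^ α) (𝓝[>] 0) < ∞})

/-- The increment of `f` over `U \ (V 0 ∪ ⋯ ∪ V (l-1))`, by inclusion-exclusion. -/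
def increment {l : ℕ} (f : Set T → ℝ) (U : Set T) (V : Fin l → Set T) : ℝ :=
  f U - ∑ J : Finset (Fin l) with J.Nonempty, (-1 : ℝ) ^ (J.card - 1) * f (U ∩ ⋂ i ∈ J, V i)

/-- Pointwise Hölder exponent of `f` at `U₀` on the class `𝒞^l` of sets `U \ (V₁ ∪ ⋯ ∪ V_l)`. -/
def pointwiseExponentC [MeasurableSpace T] (m : Measure T) (A : Set (Set T)) (l : ℕ)
    (f : Set T → ℝ) (U₀ : Set T) : EReal :=
  sSup ((fun α : ℝ => (α : EReal)) '' {α : ℝ |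
    limsup (fun ρ : ℝ≥0∞ => ⨆ U ∈ ball m A U₀ ρ,
      ⨆ V ∈ {V : Fin l → Set T | ∀ i, V i ∈ ball m A U₀ ρ},
        ENNReal.ofReal |increment f U V| / ρ ^ α) (𝓝[>] 0) < ∞})

/-- Local Hölder exponent of `f` at `U₀` on the class `𝒞^l` of sets `U \ (V₁ ∪ ⋯ ∪ V_l)`. -/
def localExponentC [MeasurableSpace T] (m : Measure T) (A : Set (Set T)) (l : ℕ)
    (f : Set T → ℝ) (U₀ : Set T) : EReal :=
  sSup ((fun α : ℝ => (α : EReal)) '' {α : ℝ |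
    limsup (fun ρ : ℝ≥0∞ => ⨆ U ∈ ball m A U₀ ρ,
      ⨆ V ∈ {V : Fin l → Set T | ∀ i, V i ∈ ball m A U₀ ρ},
        ENNReal.ofReal |increment f U V| / dm m U (⋃ i, V i) ^ α) (𝓝[>] 0) < ∞})

/-- `O` is an open subset of `A` for the topology induced by `d_m`. -/
def IsOpenIn [MeasurableSpace T] (m : Measure T) (A O : Set (Set T)) : Prop :=
  O ⊆ A ∧ ∀ U ∈ O, ∃ ρ : ℝ≥0∞, 0 < ρ ∧ ball m A U ρ ⊆ O

/-- Doob separability of the process `Y = {Y U ; U ∈ A}` for the topology induced by `d_m`. -/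
def IsSeparableProcess [MeasurableSpace T] {Ω : Type*} [MeasurableSpace Ω] (P : Measure Ω)
    (m : Measure T) (A : Set (Set T)) (Y : Set T → Ω → ℝ) : Prop :=
  ∃ S ⊆ A, S.Countable ∧ ∃ N : Set Ω, P N = 0 ∧
    ∀ F : Set ℝ, IsClosed F → ∀ O : Set (Set T), IsOpenIn m A O →
      {ω | ∀ U ∈ O ∩ S, Y U ω ∈ F} \ {ω | ∀ U ∈ O, Y U ω ∈ F} ⊆ N

/-- `Y = {Y U ; U ∈ A}` is a stationary set-indexed Ornstein-Uhlenbeck process with parameters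
`σ` and `γ`: a mean-zero Gaussian process indexed by `A` with covariance
`σ² / (2γ) * exp (-γ m(U ∆ V))`. Only the values of `Y` at members of `A` matter. -/
structure IsSIOU [MeasurableSpace T] {Ω : Type*} [MeasurableSpace Ω] (P : Measure Ω)
    (m : Measure T) (A : Set (Set T)) (σ γ : ℝ) (Y : Set T → Ω → ℝ) : Prop where
  gaussian : IsGaussianProcess (fun (U : A) ω => Y U ω) P
  mean_zero : ∀ U ∈ A, ∫ ω, Y U ω ∂P = 0
  covariance : ∀ U ∈ A, ∀ V ∈ A,
    ∫ ω, Y U ω * Y V ω ∂P = σ ^ 2 / (2 * γ) * Real.exp (-γ * (dm m U V).toReal)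

end SetIndexed

end

noncomputable section

namespace SetIndexed

variable {T : Type*}

/-! The increment `Y U - Y V` is centred Gaussian with variance `σ²/γ (1 - exp (-γ d))`, comparable
to `d = d_m(U, V)` for small `d`; hence the exponent 1/2.

Lower bounds come from chaining along the outer approximations `g_n(U)`. High Gaussian moments make
increments at scale `k_n ^ (-1/q)` small except with probability `O(k_n ^ (-5))`, which beats the
number of pairs. Borel–Cantelli, telescoping and separability then give one almost sure uniform
Hölder condition (`IsSIOU.ae_holder`), valid at all `U₀` simultaneously.

Upper bounds come from `IsSIOU.ae_frequently_lt`: along a sequence tending to `U₀`, normalized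
increments are rarely close to 0. The null set depends on `U₀`. For the local exponent, however, it
suffices that the path be rough at points accumulating at `U₀`, so the countable class `⋃ D n`
serves all `U₀` at once. This requires non-isolated members of `⋃ D n` near `U₀`
(`NotIsolated.exists_mem_sub`), obtained by iterating `g_n` up to the whole space.

On `𝒞^l`, inclusion-exclusion is a combination of increments `Y U - Y (U ∩ ⋂ V i)`, and constant
families `V` give the converse bound. -/

/-- The real-valued pseudo-distance. -/
def rdm [MeasurableSpace T] (m : Measure T) (U V : Set T) : ℝ := (dm m U V).toReal

/-! ### Law of the increments: tails and small values -/

section Gaussian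

/-- The standard normal law charges small intervals around the origin arbitrarily little. -/
lemma exists_gaussianReal_abs_le_lt {ε : ℝ≥0∞} (hε : 0 < ε) :
    ∃ s : ℝ, 0 < s ∧ gaussianReal 0 1 {x | |x| ≤ s} < ε := by
  have h := tendsto_measure_cthickening_of_isClosed (μ := gaussianReal 0 1)
    (s := ({0} : Set ℝ)) ⟨1, one_pos, measure_ne_top _ _⟩ isClosed_singleton
  have h0 : gaussianReal 0 1 ({0} : Set ℝ) = 0 := by
    have := nullSingletonClass_gaussianReal (μ := 0) (v := 1) one_ne_zero
    exact measure_singleton _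
  rw [h0] at h
  have h1 : ∀ᶠ r in 𝓝[>] (0 : ℝ),
      gaussianReal 0 1 (Metric.cthickening r ({0} : Set ℝ)) < ε :=
    (h.mono_left nhdsWithin_le_nhds).eventually (gt_mem_nhds hε)
  obtain ⟨s, hs, hs0⟩ := (h1.and self_mem_nhdsWithin).exists
  refine ⟨s, hs0, lt_of_eq_of_lt ?_ hs⟩
  rw [Metric.cthickening_singleton _ (le_of_lt hs0)]
  congr 1
  ext x
  simp [Real.norm_eq_abs]

variable [MeasurableSpace T] {Ω : Type*} [MeasurableSpace Ω] {P : Measure Ω}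
  {m : Measure T} {A : Set (Set T)} {σ γ : ℝ} {Y : Set T → Ω → ℝ}

/-- Variance of an increment of the Ornstein-Uhlenbeck process between sets at distance `d`. -/
def incVar (σ γ d : ℝ) : ℝ := σ ^ 2 / γ * (1 - Real.exp (-γ * d))

lemma incVar_le (hγ : 0 < γ) (d : ℝ) : incVar σ γ d ≤ σ ^ 2 * d := by
  have h := Real.add_one_le_exp (-γ * d)
  calc incVar σ γ d ≤ σ ^ 2 / γ * (γ * d) :=
        mul_le_mul_of_nonneg_left (by linarith) (by positivity)
    _ = σ ^ 2 * d := by field_simp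

lemma incVar_nonneg (hγ : 0 < γ) {d : ℝ} (hd : 0 ≤ d) : 0 ≤ incVar σ γ d := by
  have h : Real.exp (-γ * d) ≤ 1 := Real.exp_le_one_iff.2 (by nlinarith)
  exact mul_nonneg (by positivity) (by linarith)

lemma incVar_mono (hγ : 0 < γ) {d e : ℝ} (h : d ≤ e) : incVar σ γ d ≤ incVar σ γ e := by
  have h : Real.exp (-γ * e) ≤ Real.exp (-γ * d) := Real.exp_le_exp.2 (by nlinarith)
  exact mul_le_mul_of_nonneg_left (by linarith) (by positivity)

/-- With `x = γ d` in `[0, 1]`, `1 + x ≤ exp x` and `1 ≤ (1 + x) (1 - x/2)` give `exp (-x) ≤ 1 -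
x/2`. -/
lemma le_incVar (hγ : 0 < γ) {d : ℝ} (hd : 0 ≤ d) (h1 : γ * d ≤ 1) :
    σ ^ 2 * d / 2 ≤ incVar σ γ d := by
  have h := Real.add_one_le_exp (γ * d)
  have hpos : 0 ≤ γ * d := by positivity
  have h2 : Real.exp (-γ * d) ≤ 1 - γ * d / 2 := by
    rw [neg_mul, Real.exp_neg, inv_le_comm₀ (Real.exp_pos _) (by linarith)]
    refine le_trans ?_ h
    rw [inv_le_iff_one_le_mul₀ (by linarith)]
    nlinarith
  calc σ ^ 2 * d / 2 = σ ^ 2 / γ * (γ * d / 2) := by field_simp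
    _ ≤ _ := mul_le_mul_of_nonneg_left (by linarith) (by positivity)

/-- The increments of the process are rescaled standard normal variables. -/
lemma IsSIOU.map_sub (hY : IsSIOU P m A σ γ Y) (hγ : 0 < γ) {U V : Set T} (hU : U ∈ A)
    (hV : V ∈ A) :
    P.map (fun ω => Y U ω - Y V ω) =
      (gaussianReal 0 1).map (fun x => √(incVar σ γ (rdm m U V)) * x) := by
  have hUg := hY.gaussian.hasGaussianLaw_eval ⟨U, hU⟩
  have hVg := hY.gaussian.hasGaussianLaw_eval ⟨V, hV⟩
  have hg : HasGaussianLaw (fun ω => Y U ω - Y V ω) P :=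
    hY.gaussian.hasGaussianLaw_fun_sub (s := ⟨U, hU⟩) (t := ⟨V, hV⟩)
  have hU2 : MemLp (Y U) 2 P := hUg.memLp_two
  have hV2 : MemLp (Y V) 2 P := hVg.memLp_two
  have hUi : Integrable (Y U) P := hUg.integrable
  have hVi : Integrable (Y V) P := hVg.integrable
  have hmean : P[fun ω => Y U ω - Y V ω] = 0 := by
    rw [integral_sub hUi hVi, hY.mean_zero U hU, hY.mean_zero V hV, sub_zero]
  have hUU : Integrable (fun ω => Y U ω * Y U ω) P := hU2.integrable_mul hU2
  have hUV : Integrable (fun ω => Y U ω * Y V ω) P := hU2.integrable_mul hV2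
  have hVV : Integrable (fun ω => Y V ω * Y V ω) P := hV2.integrable_mul hV2
  have hvar : Var[fun ω => Y U ω - Y V ω; P] = incVar σ γ (rdm m U V) := by
    rw [variance_of_integral_eq_zero hg.aemeasurable hmean]
    have e : ∀ ω, (Y U ω - Y V ω) ^ 2
        = Y U ω * Y U ω - 2 * (Y U ω * Y V ω) + Y V ω * Y V ω := fun ω => by ring
    simp_rw [e]
    have hs : Integrable (fun ω => Y U ω * Y U ω - 2 * (Y U ω * Y V ω)) P :=
      hUU.sub (hUV.const_mul 2)
    rw [integral_add hs hVV, integral_sub hUU (hUV.const_mul 2),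
      integral_const_mul, hY.covariance U hU U hU, hY.covariance V hV V hV,
      hY.covariance U hU V hV]
    simp only [dm, symmDiff_self, Set.bot_eq_empty, measure_empty, ENNReal.toReal_zero, mul_zero,
      Real.exp_zero, incVar, rdm]
    field_simp
    ring
  rw [hg.map_eq_gaussianReal, hmean, hvar, gaussianReal_map_const_mul]
  congr 1
  · simp
  · ext
    simp [Real.sq_sqrt (incVar_nonneg (σ := σ) hγ (ENNReal.toReal_nonneg (a := dm m U V))), rdm,
      incVar_nonneg (σ := σ) hγ (ENNReal.toReal_nonneg (a := dm m U V))]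

lemma IsSIOU.measure_sub (hY : IsSIOU P m A σ γ Y) (hγ : 0 < γ) {U V : Set T} (hU : U ∈ A)
    (hV : V ∈ A) {B : Set ℝ} (hB : MeasurableSet B) :
    P {ω | Y U ω - Y V ω ∈ B} =
      gaussianReal 0 1 {x | √(incVar σ γ (rdm m U V)) * x ∈ B} := by
  have hg : HasGaussianLaw (fun ω => Y U ω - Y V ω) P :=
    hY.gaussian.hasGaussianLaw_fun_sub (s := ⟨U, hU⟩) (t := ⟨V, hV⟩)
  have h := DFunLike.congr_fun (hY.map_sub hγ hU hV) B
  rw [Measure.map_apply_of_aemeasurable hg.aemeasurable hB, Measure.map_apply (by fun_prop) hB] at h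
  exact h

/-- Polynomial tail bounds of every order for the increments. -/
lemma IsSIOU.exists_tail_bound (hY : IsSIOU P m A σ γ Y) (hγ : 0 < γ) (p : ℕ) :
    ∃ C : ℝ, 0 ≤ C ∧ ∀ U ∈ A, ∀ V ∈ A, ∀ t : ℝ, 0 < t →
      P {ω | t < |Y U ω - Y V ω|} ≤ ENNReal.ofReal (C * (rdm m U V ^ p / t ^ (2 * p))) := by
  set I : ℝ := ∫ x, x ^ (2 * p) ∂(gaussianReal 0 1) with hI
  have hI0 : 0 ≤ I := integral_nonneg fun x => by rw [pow_mul]; positivity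
  have hint : Integrable (fun x : ℝ => x ^ (2 * p)) (gaussianReal 0 1) := by
    by_cases hp : p = 0
    · subst hp; simp
    have h := (memLp_id_gaussianReal' (μ := 0) (v := 1) ((2 * p : ℕ) : ℝ≥0∞)
      (ENNReal.natCast_ne_top _)).integrable_norm_pow (by omega)
    refine h.congr (ae_of_all _ fun x => ?_)
    simp only [id, Real.norm_eq_abs]
    rw [pow_mul, pow_mul, sq_abs]
  refine ⟨(σ ^ 2) ^ p * I, by positivity, fun U hU V hV t ht => ?_⟩
  have hd : 0 ≤ rdm m U V := ENNReal.toReal_nonneg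
  set v := incVar σ γ (rdm m U V) with hv
  have hv0 : 0 ≤ v := incVar_nonneg hγ hd
  have hvle : v ≤ σ ^ 2 * rdm m U V := incVar_le hγ _
  have h1 : P {ω | t < |Y U ω - Y V ω|} = gaussianReal 0 1 {x | t < |√v * x|} :=
    hY.measure_sub hγ hU hV (B := {y | t < |y|}) (measurableSet_lt measurable_const (by fun_prop))
  rw [h1]
  have h2 : {x : ℝ | t < |√v * x|} ⊆ {x | t ^ (2 * p) ≤ v ^ p * x ^ (2 * p)} := by
    intro x hx
    simp only [Set.mem_ofPred_eq] at hx ⊢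
    have : t ^ 2 ≤ v * x ^ 2 := by
      calc t ^ 2 ≤ |√v * x| ^ 2 := pow_le_pow_left₀ ht.le hx.le 2
        _ = v * x ^ 2 := by rw [sq_abs, mul_pow, Real.sq_sqrt hv0]
    calc t ^ (2 * p) = (t ^ 2) ^ p := pow_mul _ _ _
      _ ≤ (v * x ^ 2) ^ p := pow_le_pow_left₀ (by positivity) this p
      _ = _ := by rw [mul_pow, pow_mul]
  refine (measure_mono h2).trans ?_
  -- Markov's inequality for the moment of order `2p`.
  have h3 := mul_meas_ge_le_integral_of_nonneg (μ := gaussianReal 0 1)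
    (f := fun x : ℝ => v ^ p * x ^ (2 * p)) (ae_of_all _ fun x => by
      simp only [Pi.zero_apply]; rw [pow_mul]; positivity) (hint.const_mul _) (t ^ (2 * p))
  rw [integral_const_mul, ← hI] at h3
  rw [← ofReal_measureReal]
  refine ENNReal.ofReal_le_ofReal ?_
  have ht2 : 0 < t ^ (2 * p) := by positivity
  have h4 : v ^ p * I ≤ (σ ^ 2) ^ p * I * rdm m U V ^ p := by
    calc v ^ p * I ≤ (σ ^ 2 * rdm m U V) ^ p * I := by gcongr
      _ = _ := by rw [mul_pow]; ring
  rw [← mul_div_assoc, le_div_iff₀ ht2, mul_comm]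
  exact h3.trans h4

/-- Along a sequence of increments whose distances shrink to zero no faster than `e j`, almost
surely the process is not Hölder continuous of any order larger than `1 / 2`. -/
lemma IsSIOU.ae_frequently_lt (hY : IsSIOU P m A σ γ Y) (hσ : 0 < σ) (hγ : 0 < γ)
    {U V : ℕ → Set T} (hU : ∀ j, U j ∈ A) (hV : ∀ j, V j ∈ A) {e : ℕ → ℝ} (he : ∀ j, 0 < e j)
    (he0 : Tendsto e atTop (𝓝 0)) {c : ℝ} (hc : 0 < c) (hd : ∀ j, c * e j ≤ rdm m (U j) (V j)) :
    ∀ᵐ ω ∂P, ∀ α : ℝ, 1 / 2 < α → ∀ C : ℝ, ∀ j₀ : ℕ, ∃ j, j₀ ≤ j ∧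
      C * e j ^ α < |Y (U j) ω - Y (V j) ω| := by
  have key : ∀ α : ℝ, 1 / 2 < α → ∀ C : ℝ, 0 < C → ∀ j₀ : ℕ, ∀ᵐ ω ∂P, ∃ j, j₀ ≤ j ∧
      C * e j ^ α < |Y (U j) ω - Y (V j) ω| := by
    intro α hα C hC j₀
    rw [ae_iff]
    -- No independence is needed: the event that the bound never fails lies in the event at any
    -- single late `j`, whose probability tends to 0.
    refine le_antisymm (le_of_forall_gt fun ε hε => ?_) zero_le
    obtain ⟨s, hs, hsε⟩ := exists_gaussianReal_abs_le_lt hε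
    set δ := α - 1 / 2 with hδ
    have hδ0 : 0 < δ := by linarith
    have hl1 : Tendsto (fun j => C * e j ^ δ) atTop (𝓝 0) := by
      have := (he0.rpow_const (p := δ) (Or.inr hδ0.le)).const_mul C
      simpa [Real.zero_rpow hδ0.ne'] using this
    have hl2 : Tendsto (fun j => γ * (c * e j)) atTop (𝓝 0) := by
      simpa using (he0.const_mul c).const_mul γ
    have hκ : 0 < s * √(σ ^ 2 * c / 2) := by positivity
    -- The first condition turns a small increment into `|x| ≤ s` for the normalized variable; the
    -- second puts `c * e j` in the range of `le_incVar`.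
    obtain ⟨j, ⟨hj1, hj2⟩, hj0⟩ := (((hl1.eventually (gt_mem_nhds hκ)).and
      (hl2.eventually (gt_mem_nhds one_pos))).and (eventually_ge_atTop j₀)).exists
    refine lt_of_le_of_lt ?_ hsε
    set v := incVar σ γ (rdm m (U j) (V j)) with hv
    have hce : 0 < c * e j := mul_pos hc (he j)
    have hvle : σ ^ 2 * (c * e j) / 2 ≤ v :=
      (le_incVar hγ hce.le hj2.le).trans (incVar_mono hγ (hd j))
    have h1 : P {ω | |Y (U j) ω - Y (V j) ω| ≤ C * e j ^ α}
        = gaussianReal 0 1 {x | |√v * x| ≤ C * e j ^ α} :=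
      hY.measure_sub hγ (hU j) (hV j) (B := {y | |y| ≤ C * e j ^ α})
        (measurableSet_le (by fun_prop) measurable_const)
    calc P {ω | ¬ ∃ j, j₀ ≤ j ∧ C * e j ^ α < |Y (U j) ω - Y (V j) ω|}
        ≤ P {ω | |Y (U j) ω - Y (V j) ω| ≤ C * e j ^ α} := by
          refine measure_mono fun ω hω => ?_
          simp only [Set.mem_ofPred_eq, not_exists, not_and, not_lt] at hω ⊢
          exact hω j hj0
      _ = _ := h1
      _ ≤ _ := by
          refine measure_mono fun x hx => ?_
          simp only [Set.mem_ofPred_eq] at hx ⊢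
          have h2 : √(σ ^ 2 * c / 2) * √(e j) ≤ √v := by
            rw [← Real.sqrt_mul (by positivity)]
            exact Real.sqrt_le_sqrt (by linarith)
          have h3 : e j ^ α = e j ^ δ * √(e j) := by
            rw [Real.sqrt_eq_rpow, ← Real.rpow_add (he j)]; congr 1; linarith
          have hse : 0 < √(e j) := Real.sqrt_pos.2 (he j)
          have hk : 0 < √(σ ^ 2 * c / 2) := by positivity
          rw [abs_mul, abs_of_nonneg (Real.sqrt_nonneg _), h3] at hx
          by_contra hcon
          push Not at hcon
          have h4 : √(σ ^ 2 * c / 2) * √(e j) * s < √v * |x| := by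
            calc _ < √(σ ^ 2 * c / 2) * √(e j) * |x| := by gcongr
              _ ≤ _ := by gcongr
          nlinarith
  -- Countably many exponents and constants suffice, since `e j ^ α` decreases in `α` once `e j <
  -- 1`.
  have hall : ∀ᵐ ω ∂P, ∀ k n j₀ : ℕ, ∃ j, j₀ ≤ j ∧
      ((n : ℝ) + 1) * e j ^ ((1 : ℝ) / 2 + 1 / ((k : ℝ) + 1)) < |Y (U j) ω - Y (V j) ω| := by
    simp only [ae_all_iff]
    intro k n j₀
    exact key _ (by have : 0 < 1 / ((k : ℝ) + 1) := by positivity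
                    linarith) _ (by positivity) j₀
  filter_upwards [hall] with ω hω α hα C j₀
  obtain ⟨k, hk⟩ := exists_nat_one_div_lt (sub_pos.2 hα)
  obtain ⟨n, hn⟩ := exists_nat_ge C
  obtain ⟨j₁, hj₁⟩ := (he0.eventually (gt_mem_nhds one_pos)).exists_forall_of_atTop
  obtain ⟨j, hj, hlt⟩ := hω k n (max j₀ j₁)
  refine ⟨j, (le_max_left _ _).trans hj, lt_of_le_of_lt ?_ hlt⟩
  have hej := hj₁ j ((le_max_right _ _).trans hj)
  have : e j ^ α ≤ e j ^ ((1 : ℝ) / 2 + 1 / ((k : ℝ) + 1)) :=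
    Real.rpow_le_rpow_of_exponent_ge (he j) hej.le (by linarith)
  have h0 : 0 ≤ e j ^ α := (Real.rpow_pos_of_pos (he j) _).le
  calc C * e j ^ α ≤ (n + 1) * e j ^ α := by gcongr; linarith
    _ ≤ _ := by gcongr

end Gaussian

/-! ### Cardinalities and outer approximations -/

section Indexing

variable [TopologicalSpace T] {A : Set (Set T)} {D : ℕ → Finset (Set T)}

lemma IsIndexingCollection.one_le_card (hA : IsIndexingCollection A D) (n : ℕ) :
    (1 : ℝ) ≤ (D n).card := by
  have : 0 < (D n).card := Finset.card_pos.2 ⟨∅, hA.sub_empty_mem n⟩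
  exact_mod_cast this

lemma IsIndexingCollection.card_mono (hA : IsIndexingCollection A D) {n n' : ℕ} (h : n ≤ n') :
    ((D n).card : ℝ) ≤ (D n').card := by
  exact_mod_cast Finset.card_le_card (hA.sub_mono h)

/-- Cardinalities are nondecreasing, so `k n ^ (-s) ≤ k (n+1) / k n ^ (1+s)`, an admissible series.
-/
lemma IsIndexingCollection.summable_rpow_neg (hA : IsIndexingCollection A D)
    (hD : Admissible D) {s : ℝ} (hs : 0 < s) :
    Summable fun n => ((D n).card : ℝ) ^ (-s) := by
  refine Summable.of_nonneg_of_le (fun n => by positivity) (fun n => ?_) (hD s hs)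
  have hk : (0 : ℝ) < (D n).card := lt_of_lt_of_le one_pos (hA.one_le_card n)
  rw [le_div_iff₀ (Real.rpow_pos_of_pos hk _), ← Real.rpow_add hk, neg_add_cancel_comm_assoc,
    Real.rpow_one]
  exact hA.card_mono n.le_succ

lemma IsIndexingCollection.tendsto_rpow_neg (hA : IsIndexingCollection A D)
    (hD : Admissible D) {s : ℝ} (hs : 0 < s) :
    Tendsto (fun n => ((D n).card : ℝ) ^ (-s)) atTop (𝓝 0) :=
  (hA.summable_rpow_neg hD hs).tendsto_atTop_zero

lemma IsIndexingCollection.exists_card_succ_le (hA : IsIndexingCollection A D)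
    (hD : Admissible D) {δ : ℝ} (hδ : 0 < δ) :
    ∃ B : ℝ, 0 < B ∧ ∀ n, ((D (n + 1)).card : ℝ) ≤ B * ((D n).card : ℝ) ^ (1 + δ) := by
  have hs := hD δ hδ
  have hterm : ∀ n, 0 < ((D (n + 1)).card : ℝ) / ((D n).card : ℝ) ^ (1 + δ) := fun n =>
    div_pos (lt_of_lt_of_le one_pos (hA.one_le_card _))
      (Real.rpow_pos_of_pos (lt_of_lt_of_le one_pos (hA.one_le_card _)) _)
  refine ⟨_, hs.tsum_pos (fun n => (hterm n).le) 0 (hterm 0), fun n => ?_⟩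
  rw [← div_le_iff₀ (Real.rpow_pos_of_pos (lt_of_lt_of_le one_pos (hA.one_le_card _)) _)]
  exact hs.le_tsum n fun j _ => (hterm j).le

lemma IsIndexingCollection.inter_mem (hA : IsIndexingCollection A D) {U V : Set T}
    (hU : U ∈ A) (hV : V ∈ A) : U ∩ V ∈ A := by
  rw [← Set.sInter_pair]
  exact hA.sInter_mem _ (Set.insert_subset hU (Set.singleton_subset_iff.2 hV)) (by simp)

lemma IsIndexingCollection.inter_biInter_mem (hA : IsIndexingCollection A D) {l : ℕ}
    {U : Set T} (hU : U ∈ A) {V : Fin l → Set T} (hV : ∀ i, V i ∈ A) (J : Finset (Fin l)) :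
    U ∩ ⋂ i ∈ J, V i ∈ A := by
  induction J using Finset.induction_on with
  | empty => simpa using hU
  | insert i J _ ih =>
    rw [Finset.set_biInter_insert, Set.inter_left_comm]
    exact hA.inter_mem (hV i) ih

lemma IsIndexingCollection.outerApprox_mem' (hA : IsIndexingCollection A D) (n : ℕ)
    {U : Set T} (hU : U ∈ A) : outerApprox (D n) U ∈ A :=
  hA.sub_subset n _ (hA.outerApprox_mem n U hU)

lemma subset_interior_outerApprox (B : Finset (Set T)) (U : Set T) :
    U ⊆ interior (outerApprox B U) := by
  have hfin : {V : Set T | V ∈ B ∧ U ⊆ interior V}.Finite :=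
    B.finite_toSet.subset fun V hV => hV.1
  rw [outerApprox, hfin.interior_biInter]
  exact Set.subset_iInter₂ fun V hV => hV.2

lemma subset_outerApprox (B : Finset (Set T)) (U : Set T) : U ⊆ outerApprox B U :=
  (subset_interior_outerApprox B U).trans interior_subset

/-- Iterating the `n`-th outer approximation from a nonempty set ends at the whole space. -/
lemma IsIndexingCollection.induction_univ (hA : IsIndexingCollection A D) (n : ℕ)
    {p : Set T → Prop} (hp : ∀ V ∈ A, V.Nonempty → p V → p (outerApprox (D n) V))
    {V : Set T} (hV : V ∈ A) (hne : V.Nonempty) (hpV : p V) : Set.univ ∈ A ∧ p Set.univ := by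
  classical
  set s := (D n).filter fun W => W.Nonempty ∧ p W with hs
  have hstep : ∀ W ∈ A, W.Nonempty → p W → outerApprox (D n) W ∈ s := fun W hW hWne hpW =>
    Finset.mem_filter.2 ⟨hA.outerApprox_mem n W hW, hWne.mono (subset_outerApprox _ _),
      hp W hW hWne hpW⟩
  -- The finite class `s` is stable under `outerApprox (D n)`. A maximal element contains its own
  -- approximation, hence is open, and `interior_ne` leaves only the whole space.
  obtain ⟨W, hW⟩ := s.exists_maximal ⟨_, hstep V hV hne hpV⟩
  obtain ⟨hWD, hWne, hpW⟩ := Finset.mem_filter.1 hW.prop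
  have hWA := hA.sub_subset n W hWD
  have hle : outerApprox (D n) W ⊆ W :=
    hW.le_of_ge (hstep W hWA hWne hpW) (subset_outerApprox _ _)
  have hint : interior W = W := interior_subset.antisymm
    ((subset_interior_outerApprox (D n) W).trans (interior_mono hle))
  have huniv : W = Set.univ := by
    by_contra hcon
    exact hA.interior_ne W hWA hWne.ne_empty hcon hint
  exact ⟨huniv ▸ hWA, huniv ▸ hpW⟩

end Indexing

/-! ### Isolated points of the pseudo-metric space -/

section Distance

variable [MeasurableSpace T] {m : Measure T} {A : Set (Set T)} {D : ℕ → Finset (Set T)}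

lemma dm_self (U : Set T) : dm m U U = 0 := by simp [dm]

lemma dm_comm (U V : Set T) : dm m U V = dm m V U := by rw [dm, symmDiff_comm, dm]

lemma dm_triangle (U V W : Set T) : dm m U W ≤ dm m U V + dm m V W :=
  measure_symmDiff_le _ _ _

lemma rdm_nonneg (U V : Set T) : 0 ≤ rdm m U V := ENNReal.toReal_nonneg

lemma rdm_comm (U V : Set T) : rdm m U V = rdm m V U := by rw [rdm, dm_comm, rdm]

variable [TopologicalSpace T]

lemma IsIndexingCollection.dm_ne_top [IsFiniteMeasureOnCompacts m]
    (hA : IsIndexingCollection A D) {U V : Set T} (hU : U ∈ A) (hV : V ∈ A) :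
    dm m U V ≠ ∞ := by
  refine (lt_of_le_of_lt (measure_mono (Set.symmDiff_subset_union)) ?_).ne
  exact ((hA.isCompact U hU).union (hA.isCompact V hV)).measure_lt_top

lemma IsIndexingCollection.rdm_triangle [IsFiniteMeasureOnCompacts m]
    (hA : IsIndexingCollection A D) {U V W : Set T} (hU : U ∈ A) (hV : V ∈ A) (hW : W ∈ A) :
    rdm m U W ≤ rdm m U V + rdm m V W := by
  rw [rdm, rdm, rdm, ← ENNReal.toReal_add (hA.dm_ne_top hU hV) (hA.dm_ne_top hV hW)]
  exact ENNReal.toReal_mono (ENNReal.add_ne_top.2 ⟨hA.dm_ne_top hU hV, hA.dm_ne_top hV hW⟩)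
    (dm_triangle U V W)

lemma DiscretizationAssumption.exists_dm_lt (hA : IsIndexingCollection A D)
    (hD : DiscretizationAssumption m A D) {ρ : ℝ≥0∞} (hρ : 0 < ρ) :
    ∃ n, ∀ U ∈ A, dm m U (outerApprox (D n) U) < ρ := by
  obtain ⟨q, hq, M, hM, h⟩ := hD.exists_exponent
  have h0 := (hA.tendsto_rpow_neg hD.admissible (one_div_pos.2 hq)).const_mul M
  have h1 := ENNReal.tendsto_ofReal h0
  rw [mul_zero, ENNReal.ofReal_zero] at h1
  obtain ⟨n, hn⟩ := (h1.eventually (gt_mem_nhds hρ)).exists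
  refine ⟨n, fun U hU => lt_of_le_of_lt (h n U hU) ?_⟩
  rwa [neg_div]

/-- If some nonempty member of `A` is isolated, the nonempty members are all at distance zero. -/
lemma dm_eq_zero_of_not_notIsolated (hA : IsIndexingCollection A D)
    (hD : DiscretizationAssumption m A D) {W : Set T} (hW : W ∈ A) (hWne : W.Nonempty)
    (hiso : ¬ NotIsolated m A W) {V V' : Set T} (hV : V ∈ A) (hVne : V.Nonempty)
    (hV' : V' ∈ A) (hVne' : V'.Nonempty) : dm m V V' = 0 := by
  unfold NotIsolated at hiso
  push Not at hiso
  obtain ⟨ρ, hρ, hiso⟩ := hiso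
  obtain ⟨n, hn⟩ := hD.exists_dm_lt hA hρ
  -- An approximation moves a set by less than `ρ`, and no member lies at a distance in `(0, ρ)`
  -- from `W`: distance zero to `W` persists up to the whole space.
  obtain ⟨hT, hWT⟩ := hA.induction_univ n (p := fun V => dm m W V = 0) (fun V hV _ hpV => by
    by_contra hcon
    have h1 := hiso _ (hA.outerApprox_mem' n hV) (pos_iff_ne_zero.2 hcon)
    have h2 := dm_triangle (m := m) W V (outerApprox (D n) V)
    rw [hpV, zero_add] at h2
    exact absurd (lt_of_le_of_lt h2 (hn V hV)) (not_lt.2 h1)) hW hWne (dm_self W)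
  -- Otherwise positive distance to the whole space would persist along the approximations. If it
  -- dropped to zero in one move, `V` would be within `ρ` of the whole space, hence of `W`, at
  -- positive distance from `W`.
  have hfull : ∀ V ∈ A, V.Nonempty → dm m V Set.univ = 0 := by
    intro V hV hVne
    by_contra hcon
    refine (hA.induction_univ n (p := fun V => dm m V Set.univ ≠ 0) (fun V hV _ hpV h0 => ?_)
      hV hVne hcon).2 (dm_self _)
    have h1 : dm m W V ≠ 0 := fun h => hpV <| le_antisymm (by
      calc dm m V Set.univ ≤ dm m V W + dm m W Set.univ := dm_triangle _ _ _
        _ = 0 := by rw [dm_comm V W, h, hWT, add_zero]) zero_le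
    have h2 := hiso V hV (pos_iff_ne_zero.2 h1)
    have h3 : dm m W V < ρ := by
      calc dm m W V ≤ dm m W Set.univ + dm m Set.univ V := dm_triangle _ _ _
        _ = dm m V Set.univ := by rw [hWT, zero_add, dm_comm]
        _ ≤ dm m V (outerApprox (D n) V) + dm m (outerApprox (D n) V) Set.univ :=
          dm_triangle _ _ _
        _ = dm m V (outerApprox (D n) V) := by rw [h0, add_zero]
        _ < ρ := hn V hV
    exact absurd h3 (not_lt.2 h2)
  refine le_antisymm ?_ zero_le
  calc dm m V V' ≤ dm m V Set.univ + dm m Set.univ V' := dm_triangle _ _ _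
    _ = 0 := by rw [hfull V hV hVne, dm_comm, hfull V' hV' hVne', add_zero]

/-- Once some member of `A` is not isolated, no nonempty member is isolated. -/
lemma NotIsolated.of_nonempty (hA : IsIndexingCollection A D)
    (hD : DiscretizationAssumption m A D) {U W : Set T} (hU : U ∈ A) (hUi : NotIsolated m A U)
    (hW : W ∈ A) (hWne : W.Nonempty) : NotIsolated m A W := by
  by_contra hiso
  obtain ⟨U₁, hU₁, h1, -⟩ := hUi 1 one_pos
  obtain ⟨U₂, hU₂, h2, h21⟩ := hUi _ h1
  have key : ∀ V ∈ A, ∀ V' ∈ A, V.Nonempty → V'.Nonempty → dm m V V' = 0 :=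
    fun V hV V' hV' hne hne' => dm_eq_zero_of_not_notIsolated hA hD hW hWne hiso hV hne hV' hne'
  -- As nonempty members are at mutual distance zero, distances from `U` take at most one positive
  -- value, whereas `U₁` and `U₂` give two.
  rcases U.eq_empty_or_nonempty with rfl | hUne
  · have hne : ∀ V, 0 < dm m ∅ V → V.Nonempty := fun V hV => by
      rw [Set.nonempty_iff_ne_empty]
      rintro rfl
      simp [dm_self] at hV
    have h3 := dm_triangle (m := m) ∅ U₂ U₁
    rw [key U₂ hU₂ U₁ hU₁ (hne _ h2) (hne _ h1), add_zero] at h3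
    exact absurd h21 (not_lt.2 h3)
  · have hem : ∀ V ∈ A, 0 < dm m U V → V = ∅ := fun V hV h => by
      by_contra hcon
      exact h.ne' (key U hU V hV hUne (Set.nonempty_iff_ne_empty.2 hcon))
    rw [hem U₁ hU₁ h1, hem U₂ hU₂ h2] at h21
    exact lt_irrefl _ h21

/-- Every neighbourhood of a point that is not isolated contains an approximating set that is not
isolated. -/
lemma NotIsolated.exists_mem_sub (hA : IsIndexingCollection A D)
    (hD : DiscretizationAssumption m A D) {U : Set T} (hU : U ∈ A) (hUi : NotIsolated m A U)
    {ρ : ℝ≥0∞} (hρ : 0 < ρ) :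
    ∃ n, ∃ V ∈ D n, NotIsolated m A V ∧ dm m U V < ρ := by
  -- `NotIsolated.of_nonempty` only concerns nonempty sets, so `∅` is first replaced by a close
  -- member at positive distance.
  obtain ⟨W, hW, hWne, hUW⟩ : ∃ W ∈ A, W.Nonempty ∧ dm m U W < ρ := by
    rcases U.eq_empty_or_nonempty with rfl | hUne
    · obtain ⟨W, hW, h1, h2⟩ := hUi ρ hρ
      refine ⟨W, hW, Set.nonempty_iff_ne_empty.2 ?_, h2⟩
      rintro rfl
      simp [dm_self] at h1
    · exact ⟨U, hU, hUne, by rwa [dm_self]⟩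
  obtain ⟨n, hn⟩ := hD.exists_dm_lt hA (tsub_pos_of_lt hUW)
  refine ⟨n, _, hA.outerApprox_mem n W hW, hUi.of_nonempty hA hD hU (hA.outerApprox_mem' n hW)
    (hWne.mono (subset_outerApprox _ _)), ?_⟩
  refine lt_of_le_of_lt (dm_triangle U W _) ?_
  calc dm m U W + dm m W (outerApprox (D n) W) < dm m U W + (ρ - dm m U W) :=
        ENNReal.add_lt_add_left hUW.ne_top (hn W hW)
    _ = ρ := add_tsub_cancel_of_le hUW.le

end Distance

/-! ### Scales and deterministic chaining -/

section Scale

/-- The scale `k n ^ (-1 / q)` of the `n`-th approximation. -/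
def scale (D : ℕ → Finset (Set T)) (q : ℝ) (n : ℕ) : ℝ := ((D n).card : ℝ) ^ (-1 / q)

lemma scale_rpow {D : ℕ → Finset (Set T)} {q : ℝ} (n : ℕ) (s : ℝ) :
    scale D q n ^ s = ((D n).card : ℝ) ^ (-(s / q)) := by
  rw [scale, ← Real.rpow_mul (by positivity)]
  congr 1
  ring

variable [TopologicalSpace T] {A : Set (Set T)} {D : ℕ → Finset (Set T)} {q : ℝ}

lemma IsIndexingCollection.scale_pos (hA : IsIndexingCollection A D) (n : ℕ) :
    0 < scale D q n :=
  Real.rpow_pos_of_pos (lt_of_lt_of_le one_pos (hA.one_le_card n)) _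

lemma IsIndexingCollection.scale_anti (hA : IsIndexingCollection A D) (hq : 0 < q) {n n' : ℕ}
    (h : n ≤ n') : scale D q n' ≤ scale D q n :=
  Real.rpow_le_rpow_of_nonpos (lt_of_lt_of_le one_pos (hA.one_le_card n)) (hA.card_mono h)
    (by rw [neg_div]; have := one_div_pos.2 hq; linarith)

lemma IsIndexingCollection.summable_scale_rpow (hA : IsIndexingCollection A D)
    (hD : Admissible D) (hq : 0 < q) {s : ℝ} (hs : 0 < s) :
    Summable fun n => scale D q n ^ s := by
  simp_rw [scale_rpow]
  exact hA.summable_rpow_neg hD (by positivity)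

lemma IsIndexingCollection.tendsto_scale_rpow (hA : IsIndexingCollection A D)
    (hD : Admissible D) (hq : 0 < q) {s : ℝ} (hs : 0 < s) :
    Tendsto (fun n => scale D q n ^ s) atTop (𝓝 0) :=
  (hA.summable_scale_rpow hD hq hs).tendsto_atTop_zero

lemma IsIndexingCollection.tendsto_scale (hA : IsIndexingCollection A D)
    (hD : Admissible D) (hq : 0 < q) : Tendsto (scale D q) atTop (𝓝 0) := by
  simpa using hA.tendsto_scale_rpow hD hq one_pos

/-- Admissibility limits the gap between consecutive scales: a distance lying between them costs
only a factor `1 + δ` in the exponent. -/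
lemma IsIndexingCollection.exists_scale_rpow_le (hA : IsIndexingCollection A D)
    (hD : Admissible D) (hq : 0 < q) {δ α : ℝ} (hδ : 0 < δ) (hα : 0 < α) :
    ∃ B : ℝ, 0 < B ∧ ∀ n, scale D q n ^ (α * (1 + δ)) ≤ B * scale D q (n + 1) ^ α := by
  obtain ⟨B, hB, h⟩ := hA.exists_card_succ_le hD hδ
  refine ⟨B ^ (α / q), Real.rpow_pos_of_pos hB _, fun n => ?_⟩
  have hk : (0 : ℝ) < (D n).card := lt_of_lt_of_le one_pos (hA.one_le_card n)
  have hk' : (0 : ℝ) < (D (n + 1)).card := lt_of_lt_of_le one_pos (hA.one_le_card _)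
  have h1 : ((D (n + 1)).card : ℝ) ^ (α / q) ≤
      B ^ (α / q) * ((D n).card : ℝ) ^ (α * (1 + δ) / q) := by
    calc ((D (n + 1)).card : ℝ) ^ (α / q)
        ≤ (B * ((D n).card : ℝ) ^ (1 + δ)) ^ (α / q) :=
          Real.rpow_le_rpow hk'.le (h n) (by positivity)
      _ = _ := by
          rw [Real.mul_rpow hB.le (by positivity), ← Real.rpow_mul hk.le]
          congr 2
          ring
  rw [scale_rpow, scale_rpow, Real.rpow_neg hk.le, Real.rpow_neg hk'.le, ← div_eq_mul_inv,
    le_div_iff₀ (Real.rpow_pos_of_pos hk' _), inv_mul_le_iff₀ (Real.rpow_pos_of_pos hk _),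
    mul_comm (_ ^ _)]
  exact h1

/-- A control of `f` at every scale is a Hölder condition. -/
lemma IsIndexingCollection.exists_holder_of_scale [MeasurableSpace T] {m : Measure T}
    (hA : IsIndexingCollection A D) (hD : Admissible D) (hq : 0 < q) {f : Set T → ℝ}
    {δ α C : ℝ} (hδ : 0 < δ) (hα : 0 < α) (hC : 0 ≤ C) {n₀ : ℕ}
    (hf : ∀ n, n₀ ≤ n → ∀ U ∈ A, ∀ V ∈ A, rdm m U V < scale D q n →
      |f U - f V| ≤ C * scale D q n ^ (α * (1 + δ))) :
    ∃ h > 0, ∃ C' ≥ 0, ∀ U ∈ A, ∀ V ∈ A, rdm m U V < h → |f U - f V| ≤ C' * rdm m U V ^ α := by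
  obtain ⟨B, hB, hBn⟩ := hA.exists_scale_rpow_le hD hq hδ hα
  refine ⟨scale D q n₀, hA.scale_pos n₀, C * B, by positivity, fun U hU V hV hUV => ?_⟩
  rcases (rdm_nonneg (m := m) U V).eq_or_lt with h0 | h0
  -- Distance zero is below every scale, so the bound passes to the limit.
  · rw [← h0, Real.zero_rpow hα.ne', mul_zero]
    refine ge_of_tendsto (x := atTop) (b := |f U - f V|)
      (by simpa using (hA.tendsto_scale_rpow hD hq (s := α * (1 + δ)) (by positivity)).const_mul C)
      ?_
    filter_upwards [eventually_ge_atTop n₀] with n hn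
    exact hf n hn U hU V hV (h0 ▸ hA.scale_pos n)
  · have hex : ∃ n, scale D q n ≤ rdm m U V :=
      ((hA.tendsto_scale hD hq).eventually (gt_mem_nhds h0)).exists.imp fun n hn => hn.le
    classical
    -- The index `n + 1` is the first whose scale is at most the distance; it is not 0 because the
    -- distance is below `scale D q n₀ ≤ scale D q 0`.
    obtain ⟨n, hn⟩ : ∃ n, Nat.find hex = n + 1 := by
      refine Nat.exists_eq_succ_of_ne_zero fun hz => ?_
      have h1 := Nat.find_spec hex
      rw [hz] at h1
      exact absurd ((hA.scale_anti hq n₀.zero_le).trans h1) (not_le.2 hUV)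
    have h1 : scale D q (n + 1) ≤ rdm m U V := hn ▸ Nat.find_spec hex
    have h2 : rdm m U V < scale D q n := not_le.1 (Nat.find_min hex (by omega))
    have h3 : n₀ ≤ n := by
      by_contra hcon
      exact absurd ((hA.scale_anti hq (by omega : n + 1 ≤ n₀)).trans h1) (not_le.2 hUV)
    calc |f U - f V| ≤ C * scale D q n ^ (α * (1 + δ)) := hf n h3 U hU V hV h2
      _ ≤ C * (B * scale D q (n + 1) ^ α) := by gcongr; exact hBn n
      _ ≤ C * (B * rdm m U V ^ α) := by
        gcongr
        exact (hA.scale_pos _).le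
      _ = _ := by ring

variable [MeasurableSpace T] {m : Measure T} [IsFiniteMeasureOnCompacts m]

/-- The deterministic part of the chaining argument. -/
lemma IsIndexingCollection.exists_chaining_bound (hA : IsIndexingCollection A D)
    (hD : Admissible D) (hq : 0 < q) {M : ℝ} (hM : 0 ≤ M)
    (hg : ∀ n, ∀ U ∈ A, rdm m U (outerApprox (D n) U) ≤ M * scale D q n)
    {f : Set T → ℝ} {S : Set (Set T)} (hS : S ⊆ A) {a a' : ℝ} (ha' : 0 < a') (haa : a' < a)
    {n₀ : ℕ}
    (hf : ∀ n, n₀ ≤ n → ∀ V ∈ D (n + 1), ∀ W ∈ D (n + 1),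
      rdm m V W ≤ (2 * M + 1) * scale D q n → |f V - f W| ≤ scale D q n ^ a)
    (hlim : ∀ U ∈ S, Tendsto (fun n => f (outerApprox (D n) U)) atTop (𝓝 (f U))) :
    ∃ C : ℝ, 0 ≤ C ∧ ∀ n, n₀ ≤ n → ∀ U ∈ S, ∀ V ∈ S, rdm m U V ≤ scale D q n →
      |f U - f V| ≤ C * scale D q n ^ a' := by
  have hsum := hA.summable_scale_rpow hD hq (sub_pos.2 haa)
  have hspos : ∀ n (s : ℝ), 0 < scale D q n ^ s := fun n s =>
    Real.rpow_pos_of_pos (hA.scale_pos n) s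
  set L : ℝ := ∑' n, scale D q n ^ (a - a') with hL
  have hL0 : 0 ≤ L := tsum_nonneg fun n => (hspos n _).le
  -- The part `a - a'` of the exponent pays for summability over `j`; the part `a'` keeps the factor
  -- at scale `n`.
  have hterm : ∀ n j, n ≤ j → scale D q j ^ a ≤ scale D q n ^ a' * scale D q j ^ (a - a') := by
    intro n j hnj
    calc scale D q j ^ a = scale D q j ^ a' * scale D q j ^ (a - a') := by
          rw [← Real.rpow_add (hA.scale_pos j)]; congr 1; ring
      _ ≤ _ := by
        gcongr
        · exact (hspos j _).le
        · exact (hA.scale_pos j).le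
        · exact hA.scale_anti hq hnj
  have htail : ∀ n, n₀ ≤ n → ∀ U ∈ S,
      |f (outerApprox (D n) U) - f U| ≤ L * scale D q n ^ a' := by
    intro n hn U hU
    refine le_of_tendsto ((tendsto_const_nhds.sub (hlim U hU)).abs) ?_
    filter_upwards [eventually_ge_atTop n] with N hN
    -- Consecutive approximations both belong to `D (j + 1)` and are at most `2 * M * scale D q j`
    -- apart.
    have h1 := dist_le_Ico_sum_of_dist_le (f := fun j => f (outerApprox (D j) U)) hN
      (d := fun j => scale D q n ^ a' * scale D q j ^ (a - a')) (fun {j} hj _ => by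
        rw [Real.dist_eq]
        refine (hf j (hn.trans hj) _ (hA.sub_mono j.le_succ (hA.outerApprox_mem j U (hS hU))) _
          (hA.outerApprox_mem (j + 1) U (hS hU)) ?_).trans (hterm n j hj)
        have h2 := hA.rdm_triangle (m := m) (hA.outerApprox_mem' j (hS hU)) (hS hU)
          (hA.outerApprox_mem' (j + 1) (hS hU))
        rw [rdm_comm _ U] at h2
        have h3 := hg j U (hS hU)
        have h4 := hg (j + 1) U (hS hU)
        have h5 := mul_le_mul_of_nonneg_left (hA.scale_anti hq j.le_succ) hM
        have h6 := hA.scale_pos (q := q) j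
        linarith)
    rw [Real.dist_eq, ← Finset.mul_sum, mul_comm] at h1
    refine h1.trans (mul_le_mul_of_nonneg_right ?_ (hspos n _).le)
    exact hsum.sum_le_tsum _ fun j _ => (hspos j _).le
  -- Three pieces: `U` to `g_n(U)`, `g_n(U)` to `g_n(V)`, `g_n(V)` to `V`. The middle one needs the
  -- full `2 * M + 1`.
  refine ⟨3 * L, by positivity, fun n hn U hU V hV hUV => ?_⟩
  have h1 := htail n hn U hU
  have h2 := htail n hn V hV
  have h3 : |f (outerApprox (D n) U) - f (outerApprox (D n) V)| ≤
      L * scale D q n ^ a' := by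
    refine (hf n hn _ (hA.sub_mono n.le_succ (hA.outerApprox_mem n U (hS hU))) _
      (hA.sub_mono n.le_succ (hA.outerApprox_mem n V (hS hV))) ?_).trans ?_
    · have h4 := hA.rdm_triangle (m := m) (hA.outerApprox_mem' n (hS hU)) (hS hU) (hS hV)
      have h5 := hA.rdm_triangle (m := m) (hA.outerApprox_mem' n (hS hU)) (hS hV)
        (hA.outerApprox_mem' n (hS hV))
      rw [rdm_comm _ U] at h4
      have h6 := hg n U (hS hU)
      have h7 := hg n V (hS hV)
      linarith
    · refine (hterm n n le_rfl).trans ?_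
      rw [mul_comm]
      exact mul_le_mul_of_nonneg_right (hsum.le_tsum n fun j _ => (hspos j _).le) (hspos n _).le
  rw [abs_le] at *
  constructor <;> linarith [h1.1, h1.2, h2.1, h2.2, h3.1, h3.2]

end Scale

/-! ### Separability, Borel–Cantelli and uniform Hölder continuity -/

section Chaining

variable [MeasurableSpace T] {m : Measure T} {A : Set (Set T)} {D : ℕ → Finset (Set T)} {q : ℝ}
  {Ω : Type*} [MeasurableSpace Ω] {P : Measure Ω} {σ γ : ℝ} {Y : Set T → Ω → ℝ}

lemma isOpenIn_ball (m : Measure T) (A : Set (Set T)) (U : Set T) (ρ : ℝ≥0∞) :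
    IsOpenIn m A (ball m A U ρ) := by
  refine ⟨fun V hV => hV.1, fun V hV => ⟨ρ - dm m U V, tsub_pos_of_lt hV.2, fun W hW =>
    ⟨hW.1, lt_of_le_of_lt (dm_triangle U V W) ?_⟩⟩⟩
  calc dm m U V + dm m V W < dm m U V + (ρ - dm m U V) :=
        ENNReal.add_lt_add_left hV.2.ne_top hW.2
    _ = ρ := add_tsub_cancel_of_le hV.2.le

/-- The values of a separable process are limits of its values on a countable set. -/
lemma IsSeparableProcess.exists_countable (h : IsSeparableProcess P m A Y) :
    ∃ S ⊆ A, S.Countable ∧ ∀ᵐ ω ∂P, ∀ U ∈ A, ∀ ρ : ℝ≥0∞, 0 < ρ → ∀ ε : ℝ, 0 < ε →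
      ∃ V ∈ S, dm m U V < ρ ∧ |Y U ω - Y V ω| < ε := by
  obtain ⟨S, hS, hSc, N, hN, hsep⟩ := h
  refine ⟨S, hS, hSc, ?_⟩
  filter_upwards [measure_eq_zero_iff_ae_notMem.1 hN] with ω hω U hU ρ hρ ε hε
  -- Off `N`, which serves all closed sets, separability applied to the closure of the values
  -- sampled in the ball puts `Y U ω` in it.
  set F : Set ℝ := closure ((fun V => Y V ω) '' (ball m A U ρ ∩ S)) with hF
  have hmem : Y U ω ∈ F := by
    by_contra hcon
    refine hω (hsep F isClosed_closure _ (isOpenIn_ball m A U ρ) ⟨fun V hV => ?_, fun hall => ?_⟩)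
    · exact subset_closure ⟨V, hV, rfl⟩
    · exact hcon (hall U ⟨hU, by rwa [dm_self]⟩)
  obtain ⟨_, ⟨V, hV, rfl⟩, hlt⟩ := Metric.mem_closure_iff.1 hmem ε hε
  exact ⟨V, hV.2, hV.1.2, hlt⟩

variable [TopologicalSpace T]

/-- The moment bound is of order `k n ^ (-(1 - 2a) p / q)`, and `p` is free since `a < 1/2`. The
power 5 is what `IsSIOU.ae_eventually_pairs` needs. -/
lemma IsSIOU.exists_tail_bound_scale (hA : IsIndexingCollection A D) (hY : IsSIOU P m A σ γ Y)
    (hγ : 0 < γ) (hq : 0 < q) {a : ℝ} (ha : a < 1 / 2) {K : ℝ} (hK : 0 ≤ K) :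
    ∃ C : ℝ, 0 ≤ C ∧ ∀ n, ∀ U ∈ A, ∀ V ∈ A, rdm m U V ≤ K * scale D q n →
      P {ω | scale D q n ^ a < |Y U ω - Y V ω|} ≤
        ENNReal.ofReal (C * ((D n).card : ℝ) ^ (-5 : ℝ)) := by
  have h12 : 0 < 1 - 2 * a := by linarith
  obtain ⟨p, hp⟩ := exists_nat_ge (5 * q / (1 - 2 * a))
  obtain ⟨C, hC, h⟩ := hY.exists_tail_bound hγ p
  refine ⟨C * K ^ p, by positivity, fun n U hU V hV hUV => ?_⟩
  have hs := hA.scale_pos (q := q) n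
  refine (h U hU V hV _ (Real.rpow_pos_of_pos hs a)).trans (ENNReal.ofReal_le_ofReal ?_)
  rw [mul_assoc]
  refine mul_le_mul_of_nonneg_left ?_ hC
  have h1 : scale D q n ^ p / (scale D q n ^ a) ^ (2 * p)
      = ((D n).card : ℝ) ^ (-((1 - 2 * a) * p / q)) := by
    rw [← scale_rpow, ← Real.rpow_natCast, ← Real.rpow_natCast, ← Real.rpow_mul hs.le,
      ← Real.rpow_sub hs]
    congr 1
    push_cast
    ring
  have h2 : ((D n).card : ℝ) ^ (-((1 - 2 * a) * p / q)) ≤ ((D n).card : ℝ) ^ (-5 : ℝ) := by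
    refine Real.rpow_le_rpow_of_exponent_le (hA.one_le_card n) (neg_le_neg ?_)
    rw [le_div_iff₀ hq]
    rw [div_le_iff₀ h12] at hp
    linarith
  calc rdm m U V ^ p / (scale D q n ^ a) ^ (2 * p)
      ≤ (K * scale D q n) ^ p / (scale D q n ^ a) ^ (2 * p) := by
        gcongr
        exact rdm_nonneg U V
    _ = K ^ p * (scale D q n ^ p / (scale D q n ^ a) ^ (2 * p)) := by rw [mul_pow, mul_div_assoc]
    _ ≤ _ := by rw [h1]; gcongr

/-- Borel–Cantelli at one `U`; used on the countable separant to identify the limit of `Y` along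
`g_n(U)`. -/
lemma IsSIOU.ae_eventually_approx (hA : IsIndexingCollection A D) (hD : Admissible D)
    (hY : IsSIOU P m A σ γ Y) (hγ : 0 < γ) (hq : 0 < q) {a : ℝ} (ha : a < 1 / 2) {M : ℝ}
    (hM : 0 ≤ M) (hg : ∀ n, ∀ U ∈ A, rdm m U (outerApprox (D n) U) ≤ M * scale D q n)
    {U : Set T} (hU : U ∈ A) :
    ∀ᵐ ω ∂P, ∀ᶠ n in atTop, |Y U ω - Y (outerApprox (D n) U) ω| ≤ scale D q n ^ a := by
  obtain ⟨C, hC, h⟩ := hY.exists_tail_bound_scale hA hγ hq ha hM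
  have hsum : ∑' n, P {ω | scale D q n ^ a < |Y U ω - Y (outerApprox (D n) U) ω|} ≠ ∞ :=
    ne_top_of_le_ne_top (((hA.summable_rpow_neg hD (s := 5) (by norm_num)).mul_left
      C).tsum_ofReal_ne_top) (ENNReal.tsum_le_tsum fun n =>
        h n U hU _ (hA.outerApprox_mem' n hU) (hg n U hU))
  filter_upwards [ae_eventually_notMem hsum] with ω hω
  filter_upwards [hω] with n hn
  exact not_lt.1 hn

/-- There are `k (n+1) ^ 2 ≤ B² k n ^ 4` pairs (admissibility with `δ = 1`), so the union bound
leaves the summable `k n ^ (-1)`. -/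
lemma IsSIOU.ae_eventually_pairs (hA : IsIndexingCollection A D) (hD : Admissible D)
    (hY : IsSIOU P m A σ γ Y) (hγ : 0 < γ) (hq : 0 < q) {a : ℝ} (ha : a < 1 / 2) {K : ℝ}
    (hK : 0 ≤ K) :
    ∀ᵐ ω ∂P, ∀ᶠ n in atTop, ∀ V ∈ D (n + 1), ∀ W ∈ D (n + 1),
      rdm m V W ≤ K * scale D q n → |Y V ω - Y W ω| ≤ scale D q n ^ a := by
  obtain ⟨C, hC, h⟩ := hY.exists_tail_bound_scale hA hγ hq ha hK
  obtain ⟨B, hB, hBn⟩ := hA.exists_card_succ_le hD one_pos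
  set E : ℕ → Set Ω := fun n => ⋃ V ∈ D (n + 1), ⋃ W ∈ D (n + 1),
    {ω | rdm m V W ≤ K * scale D q n ∧ scale D q n ^ a < |Y V ω - Y W ω|} with hE
  have hEn : ∀ n, P (E n) ≤ ENNReal.ofReal (C * B ^ 2 * ((D n).card : ℝ) ^ (-1 : ℝ)) := by
    intro n
    have hk : (0 : ℝ) < (D n).card := lt_of_lt_of_le one_pos (hA.one_le_card n)
    have hpair : ∀ V ∈ D (n + 1), ∀ W ∈ D (n + 1),
        P {ω | rdm m V W ≤ K * scale D q n ∧ scale D q n ^ a < |Y V ω - Y W ω|} ≤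
          ENNReal.ofReal (C * ((D n).card : ℝ) ^ (-5 : ℝ)) := by
      intro V hV W hW
      by_cases hVW : rdm m V W ≤ K * scale D q n
      · simpa [hVW] using h n V (hA.sub_subset _ V hV) W (hA.sub_subset _ W hW) hVW
      · simp [hVW]
    calc P (E n) ≤ ∑ V ∈ D (n + 1), ∑ W ∈ D (n + 1),
          P {ω | rdm m V W ≤ K * scale D q n ∧ scale D q n ^ a < |Y V ω - Y W ω|} :=
          (measure_biUnion_finset_le _ _).trans
            (Finset.sum_le_sum fun V _ => measure_biUnion_finset_le _ _)
      _ ≤ ∑ V ∈ D (n + 1), ∑ W ∈ D (n + 1),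
          ENNReal.ofReal (C * ((D n).card : ℝ) ^ (-5 : ℝ)) :=
          Finset.sum_le_sum fun V hV => Finset.sum_le_sum fun W hW => hpair V hV W hW
      _ = ENNReal.ofReal (((D (n + 1)).card : ℝ) ^ 2 * (C * ((D n).card : ℝ) ^ (-5 : ℝ))) := by
          rw [ENNReal.ofReal_mul (p := _ ^ 2) (by positivity), ENNReal.ofReal_pow (by positivity),
            ENNReal.ofReal_natCast]
          simp only [Finset.sum_const, nsmul_eq_mul]
          ring
      _ ≤ _ := by
          refine ENNReal.ofReal_le_ofReal ?_
          have h1 : ((D n).card : ℝ) ^ (-1 : ℝ)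
              = (((D n).card : ℝ) ^ (1 + 1 : ℝ)) ^ 2 * ((D n).card : ℝ) ^ (-5 : ℝ) := by
            rw [← Real.rpow_natCast, ← Real.rpow_mul hk.le, ← Real.rpow_add hk]
            norm_num
          calc ((D (n + 1)).card : ℝ) ^ 2 * (C * ((D n).card : ℝ) ^ (-5 : ℝ))
              ≤ (B * ((D n).card : ℝ) ^ (1 + 1 : ℝ)) ^ 2 * (C * ((D n).card : ℝ) ^ (-5 : ℝ)) := by
                gcongr
                exact hBn n
            _ = _ := by rw [h1]; ring
  have hsum : ∑' n, P (E n) ≠ ∞ :=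
    ne_top_of_le_ne_top (((hA.summable_rpow_neg hD (s := 1) one_pos).mul_left
      (C * B ^ 2)).tsum_ofReal_ne_top) (ENNReal.tsum_le_tsum hEn)
  filter_upwards [ae_eventually_notMem hsum] with ω hω
  filter_upwards [hω] with n hn V hV W hW hVW
  by_contra hcon
  refine hn (Set.mem_iUnion₂.2 ⟨V, hV, Set.mem_iUnion₂.2 ⟨W, hW, hVW, not_le.1 hcon⟩⟩)

variable [IsFiniteMeasureOnCompacts m]

/-- Almost surely the sample paths are uniformly Hölder continuous of every order below `1 / 2`. -/
lemma IsSIOU.ae_holder (hA : IsIndexingCollection A D) (hD : DiscretizationAssumption m A D)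
    (hY : IsSIOU P m A σ γ Y) (hγ : 0 < γ) (hsep : IsSeparableProcess P m A Y)
    {α : ℝ} (hα : 0 < α) (hα2 : α < 1 / 2) :
    ∀ᵐ ω ∂P, ∃ h > 0, ∃ C ≥ 0, ∀ U ∈ A, ∀ V ∈ A, rdm m U V < h →
      |Y U ω - Y V ω| ≤ C * rdm m U V ^ α := by
  obtain ⟨q, hq, M, hM, hg⟩ := hD.exists_exponent
  have hadm := hD.admissible
  replace hg : ∀ n, ∀ U ∈ A, rdm m U (outerApprox (D n) U) ≤ M * scale D q n := fun n U hU => by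
    have h := ENNReal.toReal_mono ENNReal.ofReal_ne_top (hg n U hU)
    rwa [ENNReal.toReal_ofReal (by positivity)] at h
  -- The margins in `α < a' < a < 1/2` pay, from right to left, for the tail bounds, the chaining
  -- sum and the gap between scales.
  obtain ⟨a', ha', ha'2⟩ := exists_between hα2
  obtain ⟨a, ha, ha2⟩ := exists_between ha'2
  obtain ⟨δ, hδ, hδa⟩ : ∃ δ : ℝ, 0 < δ ∧ α * (1 + δ) = a' :=
    ⟨a' / α - 1, sub_pos.2 ((one_lt_div hα).2 ha'), by field_simp; ring⟩
  obtain ⟨S, hS, hSc, hYS⟩ := hsep.exists_countable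
  have happrox : ∀ᵐ ω ∂P, ∀ U ∈ S, ∀ᶠ n in atTop,
      |Y U ω - Y (outerApprox (D n) U) ω| ≤ scale D q n ^ a :=
    (ae_ball_iff hSc).2 fun U hU =>
      hY.ae_eventually_approx hA hadm hγ hq ha2 hM.le hg (hS hU)
  filter_upwards [hYS, happrox, hY.ae_eventually_pairs hA hadm hγ hq ha2
    (K := 2 * M + 1) (by positivity)] with ω hω1 hω2 hω3
  obtain ⟨n₀, hn₀⟩ := hω3.exists_forall_of_atTop
  have hlim : ∀ U ∈ S, Tendsto (fun n => Y (outerApprox (D n) U) ω) atTop (𝓝 (Y U ω)) := by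
    intro U hU
    rw [tendsto_iff_dist_tendsto_zero]
    refine squeeze_zero' (Eventually.of_forall fun n => dist_nonneg) ?_
      (hA.tendsto_scale_rpow hadm hq (ha'.trans ha |> hα.trans))
    filter_upwards [hω2 U hU] with n hn
    rwa [dist_comm, Real.dist_eq]
  obtain ⟨C, hC, hCn⟩ := hA.exists_chaining_bound hadm hq hM.le hg (f := fun U => Y U ω) hS
    (hα.trans ha') ha hn₀ hlim
  refine hA.exists_holder_of_scale (m := m) hadm hq (f := fun U => Y U ω) hδ hα hC (n₀ := n₀)
    fun n hn U hU V hV hUV => ?_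
  rw [hδa]
  refine le_of_forall_pos_le_add fun ε hε => ?_
  -- The strict inequality leaves room to move both sets into `S` while staying within the scale.
  have hη : 0 < (scale D q n - rdm m U V) / 2 := by linarith
  obtain ⟨U', hU', hUU', hYU⟩ := hω1 U hU _ (ENNReal.ofReal_pos.2 hη) (ε / 2) (half_pos hε)
  obtain ⟨V', hV', hVV', hYV⟩ := hω1 V hV _ (ENNReal.ofReal_pos.2 hη) (ε / 2) (half_pos hε)
  have h1 : rdm m U U' < (scale D q n - rdm m U V) / 2 := by
    rw [rdm, ← ENNReal.toReal_ofReal hη.le]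
    exact (ENNReal.toReal_lt_toReal hUU'.ne_top ENNReal.ofReal_ne_top).2 hUU'
  have h2 : rdm m V V' < (scale D q n - rdm m U V) / 2 := by
    rw [rdm, ← ENNReal.toReal_ofReal hη.le]
    exact (ENNReal.toReal_lt_toReal hVV'.ne_top ENNReal.ofReal_ne_top).2 hVV'
  have h3 := hA.rdm_triangle (m := m) (hS hU') hU (hS hV')
  have h4 := hA.rdm_triangle (m := m) hU hV (hS hV')
  rw [rdm_comm U' U] at h3
  have h5 := hCn n hn U' hU' V' hV' (by linarith)
  rw [abs_lt] at hYU hYV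
  rw [abs_le] at h5 ⊢
  constructor <;> linarith [h5.1, h5.2, hYU.1, hYU.2, hYV.1, hYV.2]

end Chaining

/-! ### From Hölder and roughness conditions to exponents -/

section Exponents

/-- Lower bound for an exponent defined by a modulus `G`. -/
lemma half_le_sSup_exponents {G : ℝ → ℝ≥0∞ → ℝ≥0∞}
    (h : ∀ α : ℝ, 0 < α → α < 1 / 2 → ∃ ρ₀ : ℝ≥0∞, 0 < ρ₀ ∧ ∃ C : ℝ≥0∞, C < ∞ ∧
      ∀ ρ, 0 < ρ → ρ < ρ₀ → G α ρ ≤ C) :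
    ((1 / 2 : ℝ) : EReal) ≤ sSup ((fun α : ℝ => (α : EReal)) '' {α : ℝ |
      limsup (G α) (𝓝[>] 0) < ∞}) := by
  by_contra hcon
  obtain ⟨x, hx1, hx2⟩ := EReal.lt_iff_exists_real_btwn.1 (not_le.1 hcon)
  have hx : x < 1 / 2 := EReal.coe_lt_coe_iff.1 hx2
  -- The maximum makes the exponent positive, as `h` requires.
  obtain ⟨ρ₀, hρ₀, C, hC, hG⟩ := h (max x (1 / 4)) (lt_max_of_lt_right (by norm_num))
    (max_lt hx (by norm_num))
  have hmem : limsup (G (max x (1 / 4))) (𝓝[>] 0) < ∞ := by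
    refine lt_of_le_of_lt (limsup_le_of_le (by isBoundedDefault) ?_) hC
    filter_upwards [Ioo_mem_nhdsGT hρ₀] with ρ hρ
    exact hG ρ hρ.1 hρ.2
  have h1 := le_sSup (show ((max x (1 / 4) : ℝ) : EReal) ∈ (fun α : ℝ => (α : EReal)) '' {α : ℝ |
    limsup (G α) (𝓝[>] 0) < ∞} from ⟨_, hmem, rfl⟩)
  have h2 : (x : EReal) ≤ ((max x (1 / 4) : ℝ) : EReal) := EReal.coe_le_coe_iff.2 (le_max_left _ _)
  exact absurd (h2.trans h1) (not_le.2 hx1)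

/-- Upper bound for an exponent defined by a modulus `G`. -/
lemma sSup_exponents_le_half {G : ℝ → ℝ≥0∞ → ℝ≥0∞}
    (h : ∀ α : ℝ, 1 / 2 < α → ∀ C : ℝ≥0∞, C < ∞ → ∀ ρ₀ : ℝ≥0∞, 0 < ρ₀ →
      ∃ ρ, 0 < ρ ∧ ρ < ρ₀ ∧ C < G α ρ) :
    sSup ((fun α : ℝ => (α : EReal)) '' {α : ℝ | limsup (G α) (𝓝[>] 0) < ∞}) ≤
      ((1 / 2 : ℝ) : EReal) := by
  refine sSup_le ?_
  rintro _ ⟨α, hα, rfl⟩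
  refine EReal.coe_le_coe_iff.2 (not_lt.1 fun hlt => ?_)
  obtain ⟨C, hC1, hC2⟩ := exists_between (show limsup (G α) (𝓝[>] 0) < ∞ from hα)
  have hev := eventually_lt_of_limsup_lt hC1 (by isBoundedDefault)
  obtain ⟨ρ₀, hρ₀, hsub⟩ := (mem_nhdsGT_iff_exists_Ioo_subset' (u' := (1 : ℝ≥0∞)) one_pos).1 hev
  obtain ⟨ρ, h0, h1, h2⟩ := h α hlt C hC2 ρ₀ hρ₀
  exact absurd (show G α ρ < C from hsub ⟨h0, h1⟩) (not_lt.2 h2.le)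

lemma sum_neg_one_pow_card_sub_one {l : ℕ} (hl : 1 ≤ l) :
    ∑ J : Finset (Fin l) with J.Nonempty, (-1 : ℝ) ^ (J.card - 1) = 1 := by
  have hne : (Finset.univ : Finset (Fin l)).Nonempty := ⟨⟨0, hl⟩, Finset.mem_univ _⟩
  have h0 : ∑ J : Finset (Fin l), (-1 : ℝ) ^ J.card = 0 := by
    have h := Finset.sum_powerset_neg_one_pow_card_of_nonempty hne
    rw [Finset.powerset_univ] at h
    exact_mod_cast h
  rw [← Finset.sum_filter_add_sum_filter_not _ (fun J : Finset (Fin l) => J.Nonempty)] at h0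
  have h1 : ∑ J : Finset (Fin l) with ¬ J.Nonempty, (-1 : ℝ) ^ J.card = 1 := by
    rw [Finset.sum_eq_single ∅]
    · simp
    · intro J hJ hJ0
      exact absurd (Finset.nonempty_iff_ne_empty.2 hJ0) (Finset.mem_filter.1 hJ).2
    · simp
  have h2 : ∑ J : Finset (Fin l) with J.Nonempty, (-1 : ℝ) ^ J.card
      = -∑ J : Finset (Fin l) with J.Nonempty, (-1 : ℝ) ^ (J.card - 1) := by
    rw [← Finset.sum_neg_distrib]
    refine Finset.sum_congr rfl fun J hJ => ?_
    have hJ : 0 < J.card := Finset.card_pos.2 (Finset.mem_filter.1 hJ).2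
    obtain ⟨k, hk⟩ := Nat.exists_eq_succ_of_ne_zero hJ.ne'
    rw [hk, Nat.succ_sub_one, pow_succ]
    ring
  linarith

/-- Since the coefficients over nonempty `J` sum to 1, `f U` can be distributed over the sum,
leaving only two-set increments. -/
lemma increment_eq_sum {l : ℕ} (hl : 1 ≤ l) (f : Set T → ℝ) (U : Set T) (V : Fin l → Set T) :
    increment f U V = ∑ J : Finset (Fin l) with J.Nonempty,
      (-1 : ℝ) ^ (J.card - 1) * (f U - f (U ∩ ⋂ i ∈ J, V i)) := by
  simp_rw [mul_sub]
  rw [Finset.sum_sub_distrib, ← Finset.sum_mul, sum_neg_one_pow_card_sub_one hl, one_mul, increment]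

lemma abs_increment_le {l : ℕ} (hl : 1 ≤ l) (f : Set T → ℝ) (U : Set T) (V : Fin l → Set T) :
    |increment f U V| ≤ ∑ J : Finset (Fin l), |f U - f (U ∩ ⋂ i ∈ J, V i)| := by
  rw [increment_eq_sum hl]
  refine (Finset.abs_sum_le_sum_abs _ _).trans ?_
  simp only [abs_mul, abs_pow, abs_neg, abs_one, one_pow, one_mul]
  exact Finset.sum_le_sum_of_subset_of_nonneg (Finset.filter_subset _ _) fun _ _ _ => abs_nonneg _

/-- Constant families reduce the upper bound for every `l` to the case `l = 1`. -/
lemma increment_const {l : ℕ} (hl : 1 ≤ l) (f : Set T → ℝ) (U V : Set T) :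
    increment f U (fun _ : Fin l => V) = f U - f (U ∩ V) := by
  rw [increment_eq_sum hl]
  have h : ∀ J ∈ (Finset.univ : Finset (Finset (Fin l))).filter (fun J => J.Nonempty),
      (-1 : ℝ) ^ (J.card - 1) * (f U - f (U ∩ ⋂ i ∈ J, V))
        = (-1 : ℝ) ^ (J.card - 1) * (f U - f (U ∩ V)) := fun J hJ => by
    have hJ : (J : Set (Fin l)).Nonempty := (Finset.mem_filter.1 hJ).2
    have hV : ⋂ i ∈ J, V = V := Set.biInter_const hJ V
    rw [hV]
  rw [Finset.sum_congr rfl h, ← Finset.sum_mul, sum_neg_one_pow_card_sub_one hl, one_mul]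

variable [MeasurableSpace T] {m : Measure T} {A : Set (Set T)} {D : ℕ → Finset (Set T)}
  {f : Set T → ℝ} {U₀ : Set T}

lemma dm_inter (m : Measure T) (U V : Set T) : dm m U (U ∩ V) = m (U \ V) := by
  rw [dm]
  congr 1
  ext x
  simp only [Set.mem_symmDiff, Set.mem_inter_iff, Set.mem_sdiff]
  tauto

lemma dm_inter_le (m : Measure T) (U V : Set T) : dm m U (U ∩ V) ≤ dm m U V := by
  rw [dm_inter]
  exact measure_mono fun x hx => Or.inl hx

/-- A point of `U` outside the intersection is missed by some `V i`, hence lies in `U ∆ V i`. -/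
lemma dm_inter_biInter_le {l : ℕ} (U : Set T) (V : Fin l → Set T) (J : Finset (Fin l)) :
    dm m U (U ∩ ⋂ i ∈ J, V i) ≤ ∑ i, dm m U (V i) := by
  rw [dm_inter]
  refine (measure_mono (t := ⋃ i, symmDiff U (V i)) fun x hx => ?_).trans
    (measure_iUnion_fintype_le _ _)
  obtain ⟨hxU, hx⟩ := hx
  simp only [Set.mem_iInter, not_forall] at hx
  obtain ⟨i, -, hi⟩ := hx
  exact Set.mem_iUnion.2 ⟨i, Or.inl ⟨hxU, hi⟩⟩

lemma dm_lt_of_mem_ball {ρ : ℝ≥0∞} {U V : Set T} (hU : U ∈ ball m A U₀ ρ)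
    (hV : V ∈ ball m A U₀ ρ) : dm m U V < 2 * ρ := by
  refine lt_of_le_of_lt (dm_triangle U U₀ V) ?_
  rw [dm_comm U U₀, two_mul]
  exact ENNReal.add_lt_add hU.2 hV.2

/-- Uniform Hölder continuity of every order below `1 / 2`, in extended form. -/
def HolderBelowHalf (m : Measure T) (A : Set (Set T)) (f : Set T → ℝ) : Prop :=
  ∀ α : ℝ, 0 < α → α < 1 / 2 → ∃ h : ℝ≥0∞, 0 < h ∧ ∃ C : ℝ≥0∞, C < ∞ ∧ ∀ U ∈ A, ∀ V ∈ A,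
    dm m U V < h → ENNReal.ofReal |f U - f V| ≤ C * dm m U V ^ α

lemma HolderBelowHalf.half_le_localExponent (hf : HolderBelowHalf m A f) (U₀ : Set T) :
    ((1 / 2 : ℝ) : EReal) ≤ localExponent m A f U₀ := by
  refine half_le_sSup_exponents fun α h0 h1 => ?_
  obtain ⟨h, hh, C, hC, H⟩ := hf α h0 h1
  refine ⟨h / 2, ENNReal.half_pos hh.ne', C, hC, fun ρ _ hρ =>
    iSup₂_le fun U hU => iSup₂_le fun V hV => ENNReal.div_le_of_le_mul ?_⟩
  refine H U hU.1 V hV.1 ((dm_lt_of_mem_ball hU hV).trans_le ?_)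
  rw [mul_comm]
  exact ENNReal.mul_le_of_le_div hρ.le

lemma HolderBelowHalf.half_le_pointwiseExponent (hf : HolderBelowHalf m A f) (U₀ : Set T) :
    ((1 / 2 : ℝ) : EReal) ≤ pointwiseExponent m A f U₀ := by
  refine half_le_sSup_exponents fun α h0 h1 => ?_
  obtain ⟨h, hh, C, hC, H⟩ := hf α h0 h1
  refine ⟨h / 2, ENNReal.half_pos hh.ne', C * 2 ^ α,
    ENNReal.mul_lt_top hC (ENNReal.rpow_lt_top_of_nonneg h0.le (by simp)), fun ρ _ hρ =>
    iSup₂_le fun U hU => iSup₂_le fun V hV => ENNReal.div_le_of_le_mul ?_⟩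
  have hUV := dm_lt_of_mem_ball hU hV
  refine (H U hU.1 V hV.1 (hUV.trans_le ?_)).trans ?_
  · rw [mul_comm]
    exact ENNReal.mul_le_of_le_div hρ.le
  · rw [mul_assoc, ← ENNReal.mul_rpow_of_nonneg _ _ h0.le]
    gcongr

lemma HolderBelowHalf.half_le_pointwiseExponentC [TopologicalSpace T]
    (hA : IsIndexingCollection A D) (hf : HolderBelowHalf m A f) (U₀ : Set T) {l : ℕ}
    (hl : 1 ≤ l) : ((1 / 2 : ℝ) : EReal) ≤ pointwiseExponentC m A l f U₀ := by
  refine half_le_sSup_exponents fun α h0 h1 => ?_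
  obtain ⟨h, hh, C, hC, H⟩ := hf α h0 h1
  have hl0 : (l : ℝ≥0∞) * 2 ≠ 0 := by simp; omega
  have hlt : (l : ℝ≥0∞) * 2 ≠ ∞ := by finiteness
  refine ⟨h / (l * 2), ENNReal.div_pos hh.ne' hlt,
    (Finset.univ : Finset (Finset (Fin l))).card * (C * (l * 2) ^ α),
    ENNReal.mul_lt_top (by simp) (ENNReal.mul_lt_top hC
      (ENNReal.rpow_lt_top_of_nonneg h0.le hlt)), fun ρ _ hρ =>
    iSup₂_le fun U hU => iSup₂_le fun V hV => ENNReal.div_le_of_le_mul ?_⟩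
  have hd : ∀ J : Finset (Fin l), dm m U (U ∩ ⋂ i ∈ J, V i) ≤ l * 2 * ρ := fun J => by
    calc dm m U (U ∩ ⋂ i ∈ J, V i) ≤ ∑ i, dm m U (V i) := dm_inter_biInter_le U V J
      _ ≤ ∑ _i : Fin l, 2 * ρ := Finset.sum_le_sum fun i _ => (dm_lt_of_mem_ball hU (hV i)).le
      _ = l * 2 * ρ := by simp [mul_assoc]
  have hρh : l * 2 * ρ < h := by
    rw [mul_comm]
    exact (ENNReal.lt_div_iff_mul_lt (Or.inl hl0) (Or.inl hlt)).1 hρ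
  calc ENNReal.ofReal |increment f U V|
      ≤ ENNReal.ofReal (∑ J : Finset (Fin l), |f U - f (U ∩ ⋂ i ∈ J, V i)|) :=
        ENNReal.ofReal_le_ofReal (abs_increment_le hl f U V)
    _ = ∑ J : Finset (Fin l), ENNReal.ofReal |f U - f (U ∩ ⋂ i ∈ J, V i)| :=
        ENNReal.ofReal_sum_of_nonneg fun _ _ => abs_nonneg _
    _ ≤ ∑ _J : Finset (Fin l), C * ((l * 2) ^ α * ρ ^ α) := by
        refine Finset.sum_le_sum fun J _ => ?_
        refine (H U hU.1 _ (hA.inter_biInter_mem hU.1 (fun i => (hV i).1) J)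
          ((hd J).trans_lt hρh)).trans ?_
        rw [← ENNReal.mul_rpow_of_nonneg _ _ h0.le]
        gcongr
        exact hd J
    _ = _ := by rw [Finset.sum_const, nsmul_eq_mul]; ring

/-- For `l = 1` the increment is `f U - f (U ∩ V)`, and `m (U \ V)` is at most the denominator's
distance `d_m(U, V)`. -/
lemma HolderBelowHalf.half_le_localExponentC [TopologicalSpace T]
    (hA : IsIndexingCollection A D) (hf : HolderBelowHalf m A f) (U₀ : Set T) :
    ((1 / 2 : ℝ) : EReal) ≤ localExponentC m A 1 f U₀ := by
  refine half_le_sSup_exponents fun α h0 h1 => ?_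
  obtain ⟨h, hh, C, hC, H⟩ := hf α h0 h1
  refine ⟨h / 2, ENNReal.half_pos hh.ne', C, hC, fun ρ _ hρ =>
    iSup₂_le fun U hU => iSup₂_le fun V hV => ENNReal.div_le_of_le_mul ?_⟩
  obtain ⟨W, rfl⟩ : ∃ W, V = fun _ => W := ⟨V 0, funext fun i => by rw [Subsingleton.elim i 0]⟩
  have hW : W ∈ ball m A U₀ ρ := hV 0
  rw [increment_const le_rfl, Set.iUnion_const]
  have hle := dm_inter_le m U W
  refine (H U hU.1 _ (hA.inter_mem hU.1 hW.1)
    (hle.trans_lt ((dm_lt_of_mem_ball hU hW).trans_le ?_))).trans (by gcongr)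
  rw [mul_comm]
  exact ENNReal.mul_le_of_le_div hρ.le

/-- At `U₀`, the increments of `f` from `U₀` violate every Hölder condition of order above
`1 / 2`. -/
def RoughAt (m : Measure T) (A : Set (Set T)) (f : Set T → ℝ) (U₀ : Set T) : Prop :=
  ∀ α : ℝ, 1 / 2 < α → ∀ C : ℝ≥0∞, C < ∞ → ∀ ρ : ℝ≥0∞, 0 < ρ → ∃ U ∈ A, 0 < dm m U₀ U ∧
    dm m U₀ U < ρ ∧ C * dm m U₀ U ^ α < ENNReal.ofReal |f U - f U₀|

/-- At `U₀`, the increments of `f` over differences of two sets, one of which is `U₀`, violate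
every Hölder condition of order above `1 / 2`. -/
def RoughDiffAt (m : Measure T) (A : Set (Set T)) (f : Set T → ℝ) (U₀ : Set T) : Prop :=
  ∀ α : ℝ, 1 / 2 < α → ∀ C : ℝ≥0∞, C < ∞ → ∀ ρ : ℝ≥0∞, 0 < ρ → ∃ U ∈ A, ∃ V ∈ A,
    (U = U₀ ∨ V = U₀) ∧ 0 < dm m U V ∧ dm m U V < ρ ∧
      C * dm m U V ^ α < ENNReal.ofReal |f U - f (U ∩ V)|

lemma lt_div_rpow {C x d : ℝ≥0∞} {α : ℝ} (hα : 0 < α) (h0 : 0 < d) (ht : d ≠ ∞)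
    (h : C * d ^ α < x) : C < x / d ^ α :=
  (ENNReal.lt_div_iff_mul_lt (Or.inl (ENNReal.rpow_pos h0 ht).ne')
    (Or.inl (ENNReal.rpow_ne_top_of_nonneg hα.le ht))).2 h

lemma lt_div_two_mul_rpow {C x d : ℝ≥0∞} {α : ℝ} (hα : 0 < α) (h0 : 0 < d) (ht : d ≠ ∞)
    (h : C * 2 ^ α * d ^ α < x) : C < x / (2 * d) ^ α :=
  lt_div_rpow hα (by positivity) (by finiteness)
    (by rwa [ENNReal.mul_rpow_of_nonneg _ _ hα.le, ← mul_assoc])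

lemma lt_two_mul {d : ℝ≥0∞} (h0 : 0 < d) (ht : d ≠ ∞) : d < 2 * d := by
  rw [two_mul]
  exact ENNReal.lt_add_right ht h0.ne'

lemma mul_two_rpow_lt_top {C : ℝ≥0∞} {α : ℝ} (hα : 0 < α) (hC : C < ∞) : C * 2 ^ α < ∞ :=
  ENNReal.mul_lt_top hC (ENNReal.rpow_lt_top_of_nonneg hα.le (by simp))

lemma mem_ball_self {ρ : ℝ≥0∞} (hU₀ : U₀ ∈ A) (hρ : 0 < ρ) : U₀ ∈ ball m A U₀ ρ :=
  ⟨hU₀, by rwa [dm_self]⟩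

lemma mem_ball_pair {ρ : ℝ≥0∞} {U V : Set T} (hU : U ∈ A) (hV : V ∈ A) (hUV : U = U₀ ∨ V = U₀)
    (hρ : dm m U V < ρ) : U ∈ ball m A U₀ ρ ∧ V ∈ ball m A U₀ ρ := by
  have h0 : 0 < ρ := lt_of_le_of_lt zero_le hρ
  rcases hUV with rfl | rfl
  · exact ⟨mem_ball_self hU h0, hV, hρ⟩
  · exact ⟨⟨hU, by rwa [dm_comm]⟩, mem_ball_self hV h0⟩

/-- Roughness at points accumulating at `U₀` bounds the local exponent at `U₀`. -/
lemma localExponent_le_half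
    (h : ∀ ρ : ℝ≥0∞, 0 < ρ → ∃ V ∈ A, dm m U₀ V < ρ ∧ RoughAt m A f V) :
    localExponent m A f U₀ ≤ ((1 / 2 : ℝ) : EReal) := by
  refine sSup_exponents_le_half fun α hα C hC ρ₀ hρ₀ => ?_
  obtain ⟨ρ, hρ, hρρ⟩ := exists_between hρ₀
  obtain ⟨V, hV, hVρ, hrough⟩ := h ρ hρ
  obtain ⟨U, hU, h0, h1, h2⟩ := hrough α hα C hC (ρ - dm m U₀ V) (tsub_pos_of_lt hVρ)
  have hUρ : dm m U₀ U < ρ := by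
    calc dm m U₀ U ≤ dm m U₀ V + dm m V U := dm_triangle _ _ _
      _ < dm m U₀ V + (ρ - dm m U₀ V) := ENNReal.add_lt_add_left hVρ.ne_top h1
      _ = ρ := add_tsub_cancel_of_le hVρ.le
  refine ⟨ρ, hρ, hρρ, lt_of_lt_of_le ?_ (le_iSup₂_of_le U ⟨hU, hUρ⟩
    (le_iSup₂_of_le V ⟨hV, hVρ⟩ le_rfl))⟩
  rw [dm_comm U V]
  exact lt_div_rpow (by linarith) h0 h1.ne_top h2

lemma RoughAt.pointwiseExponent_le_half (hU₀ : U₀ ∈ A) (h : RoughAt m A f U₀) :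
    pointwiseExponent m A f U₀ ≤ ((1 / 2 : ℝ) : EReal) := by
  refine sSup_exponents_le_half fun α hα C hC ρ₀ hρ₀ => ?_
  have hα0 : 0 < α := by linarith
  obtain ⟨U, hU, h0, h1, h2⟩ := h α hα _ (mul_two_rpow_lt_top hα0 hC) (ρ₀ / 2)
    (ENNReal.half_pos hρ₀.ne')
  have hlt := lt_two_mul h0 h1.ne_top
  -- Balls are open, so the radius is twice the distance; the factor `2 ^ α` was put in the constant
  -- beforehand.
  refine ⟨2 * dm m U₀ U, h0.trans hlt, ?_, lt_of_lt_of_le ?_ (le_iSup₂_of_le U ⟨hU, hlt⟩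
    (le_iSup₂_of_le U₀ (mem_ball_self hU₀ (h0.trans hlt)) le_rfl))⟩
  · rw [mul_comm]
    exact (ENNReal.lt_div_iff_mul_lt (by simp) (by simp)).1 h1
  · exact lt_div_two_mul_rpow hα0 h0 h1.ne_top h2

lemma RoughDiffAt.pointwiseExponentC_le_half (h : RoughDiffAt m A f U₀) {l : ℕ} (hl : 1 ≤ l) :
    pointwiseExponentC m A l f U₀ ≤ ((1 / 2 : ℝ) : EReal) := by
  refine sSup_exponents_le_half fun α hα C hC ρ₀ hρ₀ => ?_
  have hα0 : 0 < α := by linarith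
  obtain ⟨U, hU, V, hV, hUV, h0, h1, h2⟩ := h α hα _ (mul_two_rpow_lt_top hα0 hC) (ρ₀ / 2)
    (ENNReal.half_pos hρ₀.ne')
  have hlt := lt_two_mul h0 h1.ne_top
  obtain ⟨hUb, hVb⟩ := mem_ball_pair hU hV hUV hlt
  refine ⟨2 * dm m U V, h0.trans hlt, ?_, lt_of_lt_of_le ?_ (le_iSup₂_of_le U hUb
    (le_iSup₂_of_le (fun _ => V) (fun _ => hVb) le_rfl))⟩
  · rw [mul_comm]
    exact (ENNReal.lt_div_iff_mul_lt (by simp) (by simp)).1 h1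
  · rw [increment_const hl]
    exact lt_div_two_mul_rpow hα0 h0 h1.ne_top h2

lemma RoughDiffAt.localExponentC_le_half (h : RoughDiffAt m A f U₀) :
    localExponentC m A 1 f U₀ ≤ ((1 / 2 : ℝ) : EReal) := by
  refine sSup_exponents_le_half fun α hα C hC ρ₀ hρ₀ => ?_
  obtain ⟨ρ, hρ, hρρ⟩ := exists_between hρ₀
  obtain ⟨U, hU, V, hV, hUV, h0, h1, h2⟩ := h α hα C hC ρ hρ
  obtain ⟨hUb, hVb⟩ := mem_ball_pair hU hV hUV h1
  refine ⟨ρ, hρ, hρρ, lt_of_lt_of_le ?_ (le_iSup₂_of_le U hUb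
    (le_iSup₂_of_le (fun _ => V) (fun _ => hVb) le_rfl))⟩
  rw [increment_const le_rfl, Set.iUnion_const]
  exact lt_div_rpow (by linarith) h0 h1.ne_top h2

end Exponents

/-! ### Almost sure properties of the sample paths -/

section Paths

variable [MeasurableSpace T] [TopologicalSpace T] {m : Measure T} [IsFiniteMeasureOnCompacts m]
  {A : Set (Set T)} {D : ℕ → Finset (Set T)} {Ω : Type*} [MeasurableSpace Ω] {P : Measure Ω}
  {σ γ : ℝ} {Y : Set T → Ω → ℝ}

lemma IsIndexingCollection.ofReal_mul_rpow_rdm (hA : IsIndexingCollection A D) {U V : Set T}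
    (hU : U ∈ A) (hV : V ∈ A) {C α : ℝ} (hC : 0 ≤ C) (hα : 0 ≤ α) :
    ENNReal.ofReal (C * rdm m U V ^ α) = ENNReal.ofReal C * dm m U V ^ α := by
  rw [ENNReal.ofReal_mul hC, ← ENNReal.ofReal_rpow_of_nonneg (rdm_nonneg U V) hα, rdm,
    ENNReal.ofReal_toReal (hA.dm_ne_top hU hV)]

lemma IsSIOU.ae_holderBelowHalf (hA : IsIndexingCollection A D)
    (hD : DiscretizationAssumption m A D) (hY : IsSIOU P m A σ γ Y) (hγ : 0 < γ)
    (hsep : IsSeparableProcess P m A Y) :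
    ∀ᵐ ω ∂P, HolderBelowHalf m A fun U => Y U ω := by
  -- Countably many exponents increasing to 1/2; the shift by 3 keeps them positive.
  have hrat : ∀ᵐ ω ∂P, ∀ k : ℕ, ∃ h > 0, ∃ C ≥ 0, ∀ U ∈ A, ∀ V ∈ A, rdm m U V < h →
      |Y U ω - Y V ω| ≤ C * rdm m U V ^ ((1 : ℝ) / 2 - 1 / ((k : ℝ) + 3)) := by
    refine ae_all_iff.2 fun k => hY.ae_holder hA hD hγ hsep ?_ ?_
    · have : 1 / ((k : ℝ) + 3) < 1 / 2 := one_div_lt_one_div_of_lt two_pos (by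
        have : (0 : ℝ) ≤ k := k.cast_nonneg
        linarith)
      linarith
    · have : 0 < 1 / ((k : ℝ) + 3) := by positivity
      linarith
  filter_upwards [hrat] with ω hω α h0 h1
  obtain ⟨k, hk⟩ := exists_nat_one_div_lt (sub_pos.2 h1)
  obtain ⟨h, hh, C, hC, H⟩ := hω k
  have hαk : α ≤ 1 / 2 - 1 / ((k : ℝ) + 3) := by
    have : 1 / ((k : ℝ) + 3) ≤ 1 / ((k : ℝ) + 1) :=
      one_div_le_one_div_of_le (by positivity) (by linarith)
    linarith
  -- Distances below 1 allow the exponent to be lowered to `α`.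
  refine ⟨ENNReal.ofReal (min h 1), ENNReal.ofReal_pos.2 (lt_min hh one_pos), ENNReal.ofReal C,
    ENNReal.ofReal_lt_top, fun U hU V hV hUV => ?_⟩
  have hlt : rdm m U V < min h 1 := ENNReal.toReal_lt_of_lt_ofReal hUV
  rw [← hA.ofReal_mul_rpow_rdm hU hV hC h0.le]
  refine ENNReal.ofReal_le_ofReal ((H U hU V hV (hlt.trans_le (min_le_left _ _))).trans ?_)
  refine mul_le_mul_of_nonneg_left ?_ hC
  rcases (rdm_nonneg (m := m) U V).eq_or_lt with hz | hz
  · rw [← hz, Real.zero_rpow h0.ne', Real.zero_rpow (by linarith)]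
  · exact Real.rpow_le_rpow_of_exponent_ge hz (hlt.le.trans (min_le_right _ _)) hαk

lemma NotIsolated.exists_seq (hA : IsIndexingCollection A D) {U₀ : Set T} (hU₀ : U₀ ∈ A)
    (h : NotIsolated m A U₀) :
    ∃ U : ℕ → Set T, (∀ j, U j ∈ A) ∧ (∀ j, 0 < rdm m U₀ (U j)) ∧
      Tendsto (fun j => rdm m U₀ (U j)) atTop (𝓝 0) := by
  choose U hU hpos hlt using fun j : ℕ => h (ENNReal.ofReal (1 / ((j : ℝ) + 1)))
    (ENNReal.ofReal_pos.2 (by positivity))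
  refine ⟨U, hU, fun j => ENNReal.toReal_pos (hpos j).ne' (hA.dm_ne_top hU₀ (hU j)), ?_⟩
  refine squeeze_zero (fun j => rdm_nonneg _ _) (fun j => ?_)
    (tendsto_one_div_add_atTop_nhds_zero_nat (𝕜 := ℝ))
  exact (ENNReal.toReal_lt_of_lt_ofReal (hlt j)).le

lemma IsSIOU.ae_roughAt (hA : IsIndexingCollection A D) (hY : IsSIOU P m A σ γ Y) (hσ : 0 < σ)
    (hγ : 0 < γ) {U₀ : Set T} (hU₀ : U₀ ∈ A) (h : NotIsolated m A U₀) :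
    ∀ᵐ ω ∂P, RoughAt m A (fun U => Y U ω) U₀ := by
  obtain ⟨U, hU, hpos, hlim⟩ := h.exists_seq hA hU₀
  filter_upwards [hY.ae_frequently_lt hσ hγ hU (fun _ => hU₀) hpos hlim one_pos
    fun j => by rw [one_mul, rdm_comm]] with ω hω α hα C hC ρ hρ
  obtain ⟨r, -, hr, hrρ⟩ := ENNReal.lt_iff_exists_real_btwn.1 hρ
  obtain ⟨j₀, hj₀⟩ :=
    (hlim.eventually (gt_mem_nhds (ENNReal.ofReal_pos.1 hr))).exists_forall_of_atTop
  obtain ⟨j, hj, hlt⟩ := hω α hα C.toReal j₀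
  have hfin := hA.dm_ne_top (m := m) hU₀ (hU j)
  refine ⟨U j, hU j, (ENNReal.toReal_pos_iff.1 (hpos j)).1, ?_, ?_⟩
  · refine lt_trans ?_ hrρ
    rw [← ENNReal.ofReal_toReal hfin]
    exact (ENNReal.ofReal_lt_ofReal_iff (ENNReal.ofReal_pos.1 hr)).2 (hj₀ j hj)
  · rw [← ENNReal.ofReal_toReal hC.ne, ← hA.ofReal_mul_rpow_rdm hU₀ (hU j) ENNReal.toReal_nonneg
      (by linarith)]
    exact (ENNReal.ofReal_lt_ofReal_iff_of_nonneg
      (mul_nonneg ENNReal.toReal_nonneg (Real.rpow_nonneg (rdm_nonneg _ _) _))).2 hlt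

/-- One of the two one-sided differences carries half of the distance. -/
lemma IsIndexingCollection.exists_half_le_rdm_inter (hA : IsIndexingCollection A D)
    {U₀ U : Set T} (hU₀ : U₀ ∈ A) (hU : U ∈ A) :
    ∃ V ∈ A, ∃ W ∈ A, (V = U₀ ∨ W = U₀) ∧ rdm m V W = rdm m U₀ U ∧
      1 / 2 * rdm m U₀ U ≤ rdm m V (V ∩ W) := by
  have h : rdm m U₀ U ≤ rdm m U₀ (U ∩ U₀) + rdm m U (U ∩ U₀) := by
    have h1 := hA.rdm_triangle (m := m) hU₀ (hA.inter_mem hU₀ hU) hU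
    rwa [rdm_comm (U₀ ∩ U) U, Set.inter_comm U₀ U] at h1
  by_cases hc : 1 / 2 * rdm m U₀ U ≤ rdm m U₀ (U ∩ U₀)
  · rw [Set.inter_comm] at hc
    exact ⟨U₀, hU₀, U, hU, Or.inl rfl, rfl, hc⟩
  · exact ⟨U, hU, U₀, hU₀, Or.inr rfl, rdm_comm _ _, by linarith⟩

/-- For each term of a sequence tending to `U₀`, the pair is ordered so that its one-sided
difference carries at least half the distance; `IsSIOU.ae_frequently_lt` then applies with `c =
1/2`. -/
lemma IsSIOU.ae_roughDiffAt (hA : IsIndexingCollection A D) (hY : IsSIOU P m A σ γ Y)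
    (hσ : 0 < σ) (hγ : 0 < γ) {U₀ : Set T} (hU₀ : U₀ ∈ A) (h : NotIsolated m A U₀) :
    ∀ᵐ ω ∂P, RoughDiffAt m A (fun U => Y U ω) U₀ := by
  obtain ⟨U, hU, hpos, hlim⟩ := h.exists_seq hA hU₀
  choose V hV W hW hVW heq hhalf using fun j =>
    hA.exists_half_le_rdm_inter (m := m) hU₀ (hU j)
  filter_upwards [hY.ae_frequently_lt hσ hγ hV (fun j => hA.inter_mem (hV j) (hW j)) hpos hlim
    one_half_pos hhalf] with ω hω α hα C hC ρ hρ
  obtain ⟨r, -, hr, hrρ⟩ := ENNReal.lt_iff_exists_real_btwn.1 hρ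
  obtain ⟨j₀, hj₀⟩ :=
    (hlim.eventually (gt_mem_nhds (ENNReal.ofReal_pos.1 hr))).exists_forall_of_atTop
  obtain ⟨j, hj, hlt⟩ := hω α hα C.toReal j₀
  have hfin := hA.dm_ne_top (m := m) (hV j) (hW j)
  refine ⟨V j, hV j, W j, hW j, hVW j, ?_, ?_, ?_⟩
  · have h1 := hpos j
    rw [← heq j] at h1
    exact (ENNReal.toReal_pos_iff.1 h1).1
  · refine lt_trans ?_ hrρ
    rw [← ENNReal.ofReal_toReal hfin]
    exact (ENNReal.ofReal_lt_ofReal_iff (ENNReal.ofReal_pos.1 hr)).2 ((heq j).trans_lt (hj₀ j hj))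
  · rw [← ENNReal.ofReal_toReal hC.ne, ← hA.ofReal_mul_rpow_rdm (hV j) (hW j)
      ENNReal.toReal_nonneg (by linarith), heq j]
    exact (ENNReal.ofReal_lt_ofReal_iff_of_nonneg
      (mul_nonneg ENNReal.toReal_nonneg (Real.rpow_nonneg (rdm_nonneg _ _) _))).2 hlt

end Paths

end SetIndexed

end

theorem mainTheorem11 {T : Type*} [MetricSpace T] [CompleteSpace T] [LocallyCompactSpace T]
    [TopologicalSpace.SeparableSpace T] [MeasurableSpace T] [BorelSpace T]
    (m : Measure T) [m.Regular]
    (A : Set (Set T)) (D : ℕ → Finset (Set T))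
    (hA : SetIndexed.IsIndexingCollection A D)
    (hD : SetIndexed.DiscretizationAssumption m A D)
    {Ω : Type*} [MeasurableSpace Ω] (P : Measure Ω) [IsProbabilityMeasure P]
    (σ γ : ℝ) (hσ : 0 < σ) (hγ : 0 < γ) (Y : Set T → Ω → ℝ)
    (hY : SetIndexed.IsSIOU P m A σ γ Y)
    (hsep : SetIndexed.IsSeparableProcess P m A Y) :
    (∀ᵐ ω ∂P, ∀ U₀ ∈ A,
      (SetIndexed.NotIsolated m A U₀ →
        SetIndexed.localExponent m A (fun U => Y U ω) U₀ = ((1 / 2 : ℝ) : EReal)) ∧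
      ((1 / 2 : ℝ) : EReal) ≤ SetIndexed.pointwiseExponent m A (fun U => Y U ω) U₀) ∧
    (∀ U₀ ∈ A, SetIndexed.NotIsolated m A U₀ → ∀ᵐ ω ∂P,
      SetIndexed.pointwiseExponent m A (fun U => Y U ω) U₀ = ((1 / 2 : ℝ) : EReal)) ∧
    (∀ U₀ ∈ A, SetIndexed.NotIsolated m A U₀ → ∀ᵐ ω ∂P,
      (∀ l : ℕ, 1 ≤ l →
        SetIndexed.pointwiseExponentC m A l (fun U => Y U ω) U₀ = ((1 / 2 : ℝ) : EReal)) ∧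
      SetIndexed.localExponentC m A 1 (fun U => Y U ω) U₀ = ((1 / 2 : ℝ) : EReal)) := by
  have hholder := hY.ae_holderBelowHalf hA hD hγ hsep
  -- A single null set suffices because `⋃ D n` is countable; this makes the local exponent
  -- statement uniform in `U₀`.
  have hrough : ∀ᵐ ω ∂P, ∀ n, ∀ V ∈ D n, SetIndexed.NotIsolated m A V →
      SetIndexed.RoughAt m A (fun U => Y U ω) V := by
    refine ae_all_iff.2 fun n => (ae_ball_iff (D n).countable_toSet).2 fun V hV => ?_
    by_cases h : SetIndexed.NotIsolated m A V
    · filter_upwards [hY.ae_roughAt hA hσ hγ (hA.sub_subset n V hV) h] with ω hω _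
      exact hω
    · exact ae_of_all _ fun _ h' => absurd h' h
  refine ⟨?_, fun U₀ hU₀ hiso => ?_, fun U₀ hU₀ hiso => ?_⟩
  · filter_upwards [hholder, hrough] with ω hω hr U₀ hU₀
    refine ⟨fun hiso => le_antisymm ?_ (hω.half_le_localExponent U₀),
      hω.half_le_pointwiseExponent U₀⟩
    refine SetIndexed.localExponent_le_half fun ρ hρ => ?_
    obtain ⟨n, V, hV, hVi, hVρ⟩ := hiso.exists_mem_sub hA hD hU₀ hρ
    exact ⟨V, hA.sub_subset n V hV, hVρ, hr n V hV hVi⟩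
  · filter_upwards [hholder, hY.ae_roughAt hA hσ hγ hU₀ hiso] with ω hω hr
    exact le_antisymm (hr.pointwiseExponent_le_half hU₀) (hω.half_le_pointwiseExponent U₀)
  · filter_upwards [hholder, hY.ae_roughDiffAt hA hσ hγ hU₀ hiso] with ω hω hr
    exact ⟨fun l hl => le_antisymm (hr.pointwiseExponentC_le_half hl)
      (hω.half_le_pointwiseExponentC hA U₀ hl),
      le_antisymm hr.localExponentC_le_half (hω.half_le_localExponentC hA U₀)⟩
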